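/- Setting. Let $\mathcal X$ be a measurable space with a $\sigma$-finite measure $\mu$, let $\mu^k=\mu\otimes\cdots\otimes\mu$ on $\mathcal X^k$, and for each $k$ let $\rho_k$ be a metric on $\mathcal X^k$, with $(\mathcal X,\rho_1)$ separable. Let $1\le N\le\infty$. *$\Psi$-dominance.* Put $\Psi_0=0$ and, for $f\in L_1(\mathcal X^k,\mu^k)$, $k\ge1$, $\Psi_k(f)=\int_{\mathcal X^k}\max(f,0)\,d\mu^k+\Psi_{k-1}(\pi f)$, where $(\pi f)(x_2,\dots,x_k)=\int_{\mathcal X}f(x_1,\dots,x_k)\,d\mu(x_1)$. The family $(\mathcal X^k,\rho_k)_{1\le k\le N}$ ($k<\infty$) is *$\Psi$-dominated* with respect to $\mu$ if (i) whenever $x_i=y_i$, $\rho_k(x,y)=\rho_{k-1}(x',y')$, where $x',y'$ arise from $x,y\in\mathcal X^k$ by deleting the $i$-th coordinate; (ii) the product $\sigma$-algebra of $\mathcal X^k$ is the Borel $\sigma$-algebra of $\rho_k$; (iii) $\int fg\,d\mu^k\le\Psi_k(f)$ for all $f\in L_1(\mathcal X^k,\mu^k)$ and all $\rho_k$-$1$-Lipschitz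 $g:\mathcal X^k\to[0,\infty)$ with $g\le\operatorname{diam}_{\rho_k}(\mathcal X^k)$. *Mixing matrix.* Let $\mathbb P\ll\mu^n$ be a probability measure on $\mathcal X^n$ with density $p$ and coordinate process $X_1,\dots,X_n$. The law of $(X_{i+1},\dots,X_n)$ conditioned on $(X_1,\dots,X_i)=y$ is taken with density $p(y\,\cdot)/\int p(y z)\,d\mu^{n-i}(z)$. For $1\le i<j\le n$, $y\in\mathcal X^{i-1}$ and $w,w'\in\mathcal X$, let $\eta_{ij}(y,w,w')$ be the total variation distance (half the total mass of the variation of the difference) of the laws of $(X_j,\dots,X_n)$ conditioned on $(X_1,\dots,X_i)=yw$ and on $(X_1,\dots,X_i)=yw'$. Let $\bar\eta_{ij}$ be its essential supremum: the least $a\ge0$ such that, for some set $N_0\subset\mathcal X^i$ which is null for the law of $(X_1,\dots,X_i)$, $\eta_{ij}(y,w,w')\le a$ whenever $yw,yw'\notin N_0$. Let $\Delta_n=\Delta_n(\mathbb P)$ be the upper triangular $n\times n$ matrix with $1$ on the diagonal and $(\Delta_n)_{ij}=\bar\eta_{ij}$ for $i<j$, and $\|\Delta_n\|_\infty=\max_{1\le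 i\le n}\big(1+\sum_{j>i}\bar\eta_{ij}\big)$ its $\ell_\infty$ operator norm. **Theorem.** (1) Let $n\ge1$, let $(\mathcal X^k,\rho_k)_{1\le k\le n}$ be $\Psi$-dominated with respect to $\mu$, and let $\mathbb P\ll\mu^n$ be a probability measure on $\mathcal X^n$. Then every $\rho_n$-Lipschitz $f:\mathcal X^n\to\mathbb R$ is $\mathbb P$-integrable and, for all $t>0$, $$\mathbb P(|f-\mathbb E f|>t)\le 2\exp\Big(-\frac{t^2}{2n\,\mathrm{Lip}(f)^2\,\|\Delta_n\|_\infty^2}\Big),$$ where $\mathrm{Lip}(f)$ is the smallest Lipschitz constant of $f$ for $\rho_n$ (the right side is read as $0$ if $\mathrm{Lip}(f)=0$). In particular, if $f$ is $1$-Lipschitz for the normalized metric $\bar\rho_n=\rho_n/n$, then $$\mathbb P(|f-\mathbb E f|>t)\le 2\exp\Big(-\frac{nt^2}{2\|\Delta_n\|_\infty^2}\Big)\qquad(t>0).$$ (2) Let $(\mathcal X^k,\rho_k)_{k\ge1}$ be $\Psi$-dominated with respect to $\mu$, and let $\mathbb P_n\ll\mu^n$, $n\ge1$, be probability measures on $\mathcal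 X^n$ (for instance the marginals of one process) that are $\eta$-mixing, i.e. $\bar H=\sup_n\|\Delta_n(\mathbb P_n)\|_\infty<\infty$. Then $\mathbb P_n(|f-\mathbb E f|>t)\le2\exp(-nt^2/(2\bar H^2))$ for all $n\ge1$, all $f$ that are $1$-Lipschitz for $\bar\rho_n$ and all $t>0$, and the spaces $(\mathcal X^n,\bar\rho_n,\mathbb P_n)_{n\ge1}$ form a normal Lévy family: each has finite diameter, and there are constants $c_1,c_2>0$ such that $$1-\inf\{\mathbb P_n(A_t):A\text{ measurable},\ \mathbb P_n(A)\ge\tfrac12\}\le c_1e^{-c_2nt^2}\qquad(n\ge1,\ t>0),$$ where $A_t=\{x:\bar\rho_n(x,A)\le t\}$. -/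

import Mathlib

open MeasureTheory
open scoped ENNReal NNReal

noncomputable section

/-! ### Finite sequences -/

/-- The concatenation `[y z]` of two finite sequences. -/
def concat {X : Type*} {i m n : ℕ} (h : i + m = n) (y : Fin i → X) (z : Fin m → X) : Fin n → X :=
  fun k => Fin.append y z (Fin.cast h.symm k)

/-- The first `i` terms of a sequence. -/
def initialPart {X : Type*} {i m n : ℕ} (h : i + m = n) (x : Fin n → X) : Fin i → X :=
  fun k => x (Fin.cast h (Fin.castAdd m k))

/-- The last `m` terms of a sequence. -/
def finalPart {X : Type*} {i m n : ℕ} (h : i + m = n) (x : Fin n → X) : Fin m → X :=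
  fun k => x (Fin.cast h (Fin.natAdd i k))

lemma measurable_concat {X : Type*} [MeasurableSpace X] {i m n : ℕ} (h : i + m = n) :
    Measurable (fun q : (Fin i → X) × (Fin m → X) => concat h q.1 q.2) := by
  subst h
  refine measurable_pi_lambda _ fun k => ?_
  refine Fin.addCases (fun a => ?_) (fun a => ?_) k
  · simp only [concat, Fin.cast_eq_self, Fin.append_left]
    exact (measurable_pi_apply a).comp measurable_fst
  · simp only [concat, Fin.cast_eq_self, Fin.append_right]
    exact (measurable_pi_apply a).comp measurable_snd

lemma measurable_concat_right {X : Type*} [MeasurableSpace X] {i m n : ℕ} (h : i + m = n)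
    (y : Fin i → X) : Measurable (fun z : Fin m → X => concat h y z) :=
  (measurable_concat h).comp measurable_prodMk_left

lemma measurable_initialPart {X : Type*} [MeasurableSpace X] {i m n : ℕ} (h : i + m = n) :
    Measurable (initialPart h : (Fin n → X) → (Fin i → X)) :=
  measurable_pi_lambda _ fun _ => measurable_pi_apply _

lemma measurable_finalPart {X : Type*} [MeasurableSpace X] {i m n : ℕ} (h : i + m = n) :
    Measurable (finalPart h : (Fin n → X) → (Fin m → X)) :=
  measurable_pi_lambda _ fun _ => measurable_pi_apply _

lemma initialPart_concat {X : Type*} {i m n : ℕ} (h : i + m = n) (y : Fin i → X) (z : Fin m → X) :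
    initialPart h (concat h y z) = y := by
  subst h
  funext k
  simp [initialPart, concat]

/-- The product measure `μ ⊗ ⋯ ⊗ μ` on sequences of length `n`. -/
abbrev prodMeasure {X : Type*} [MeasurableSpace X] (μ : Measure X) (n : ℕ) : Measure (Fin n → X) :=
  Measure.pi fun _ => μ

lemma map_concat {X : Type*} [MeasurableSpace X] (μ : Measure X) [SigmaFinite μ] {i m n : ℕ}
    (h : i + m = n) :
    ((prodMeasure μ i).prod (prodMeasure μ m)).map (fun q => concat h q.1 q.2)
      = prodMeasure μ n := by
  subst h
  refine (Measure.pi_eq fun s hs => ?_).symm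
  rw [Measure.map_apply (measurable_concat rfl) (MeasurableSet.univ_pi hs)]
  have : (fun q : (Fin i → X) × (Fin m → X) => concat rfl q.1 q.2) ⁻¹' (Set.univ.pi s)
      = (Set.univ.pi fun k => s (Fin.castAdd m k)) ×ˢ (Set.univ.pi fun k => s (Fin.natAdd i k)) := by
    ext q
    simp only [concat, Set.mem_preimage, Set.mem_pi, Set.mem_univ, forall_const, Set.mem_prod]
    constructor
    · intro hq
      exact ⟨fun k => by simpa using hq (Fin.castAdd m k), fun k => by simpa using hq (Fin.natAdd i k)⟩
    · rintro ⟨h1, h2⟩ k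
      refine Fin.addCases (fun a => ?_) (fun a => ?_) k
      · simpa using h1 a
      · simpa using h2 a
  rw [this, Measure.prod_prod, Measure.pi_pi, Measure.pi_pi, Fin.prod_univ_add]

/-! ### Conditional laws and the mixing matrix -/

/-- For `P ≪ μ ⊗ ⋯ ⊗ μ` with density `p`, the law of `(X_{i+1}, …, X_n)` conditioned on
`(X_1, …, X_i) = y`: it has the density `z ↦ p(y z) / ∫ p(y z') dμ(z')`. That these measures
are a regular conditional law is `lintegral_condLaw` below. -/
def condLaw {X : Type*} [MeasurableSpace X] (μ : Measure X) {i m n : ℕ} (P : Measure (Fin n → X))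
    (h : i + m = n) (y : Fin i → X) : Measure (Fin m → X) :=
  (∫⁻ z, P.rnDeriv (prodMeasure μ n) (concat h y z) ∂(prodMeasure μ m))⁻¹ •
    (prodMeasure μ m).withDensity fun z => P.rnDeriv (prodMeasure μ n) (concat h y z)

/-- Disintegration: `condLaw` is a version of the conditional law given the first `i` terms. -/
theorem lintegral_condLaw {X : Type*} [MeasurableSpace X] (μ : Measure X) [SigmaFinite μ]
    {i m n : ℕ} (P : Measure (Fin n → X)) [IsProbabilityMeasure P] (hP : P ≪ prodMeasure μ n)
    (h : i + m = n) {F : (Fin n → X) → ℝ≥0∞} (hF : Measurable F) :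
    ∫⁻ x, F x ∂P
      = ∫⁻ y, ∫⁻ z, F (concat h y z) ∂(condLaw μ P h y) ∂(P.map (initialPart h)) := by
  set p := P.rnDeriv (prodMeasure μ n) with hp
  have hpm : Measurable p := Measure.measurable_rnDeriv _ _
  have hc := measurable_concat (X := X) h
  have key : ∀ G : (Fin n → X) → ℝ≥0∞, Measurable G → ∫⁻ x, G x ∂P
      = ∫⁻ y, ∫⁻ z, p (concat h y z) * G (concat h y z) ∂(prodMeasure μ m)
          ∂(prodMeasure μ i) := by
    intro G hG
    conv_lhs => rw [← Measure.withDensity_rnDeriv_eq P _ hP]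
    rw [lintegral_withDensity_eq_lintegral_mul _ hpm hG]
    rw [← map_concat μ h, lintegral_map (hpm.mul hG) hc]
    exact lintegral_prod _ ((hpm.mul hG).comp hc).aemeasurable
  set M : (Fin i → X) → ℝ≥0∞ := fun y => ∫⁻ z, p (concat h y z) ∂(prodMeasure μ m) with hM
  have hMm : Measurable M := (hpm.comp hc).lintegral_prod_right'
  set I : (Fin i → X) → ℝ≥0∞ :=
    fun y => ∫⁻ z, p (concat h y z) * F (concat h y z) ∂(prodMeasure μ m) with hI
  have hIm : Measurable I := ((hpm.mul hF).comp hc).lintegral_prod_right'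
  have hin : ∀ y, ∫⁻ z, F (concat h y z) ∂(condLaw μ P h y) = (M y)⁻¹ * I y := by
    intro y
    have := lintegral_withDensity_eq_lintegral_mul (prodMeasure μ m)
      (hpm.comp (measurable_concat_right h y)) (hF.comp (measurable_concat_right h y))
    rw [condLaw, lintegral_smul_measure]
    exact congrArg ((M y)⁻¹ * ·) this
  simp_rw [hin]
  have hmap := lintegral_map (μ := P) (hMm.inv.mul hIm) (measurable_initialPart h)
  simp only [Pi.mul_apply, Pi.inv_apply] at hmap
  rw [hmap, key F hF, key (fun x => (M (initialPart h x))⁻¹ * I (initialPart h x))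
      ((hMm.inv.mul hIm).comp (measurable_initialPart h))]
  have hone : ∫⁻ y, M y ∂(prodMeasure μ i) ≠ ⊤ := by
    have := key (fun _ => 1) measurable_const
    simp only [mul_one, lintegral_one, measure_univ] at this
    simp [hM, ← this]
  have hfin : ∀ᵐ y ∂(prodMeasure μ i), M y < ⊤ := ae_lt_top hMm hone
  refine lintegral_congr_ae ?_
  filter_upwards [hfin] with y hy
  simp_rw [initialPart_concat]
  refine Eq.trans ?_
    (lintegral_mul_const ((M y)⁻¹ * I y) (hpm.comp (measurable_concat_right h y))).symm
  change I y = M y * ((M y)⁻¹ * I y)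
  by_cases h0 : M y = 0
  · have h1 : ∀ᵐ z ∂(prodMeasure μ m), p (concat h y z) = 0 :=
      (lintegral_eq_zero_iff (hpm.comp (measurable_concat_right h y))).1 h0
    have : I y = 0 := by
      rw [hI]
      refine (lintegral_congr_ae (g := fun _ => 0) ?_).trans lintegral_zero
      filter_upwards [h1] with z hz
      simp [hz]
    simp [this]
  · rw [← mul_assoc, ENNReal.mul_inv_cancel h0 hy.ne, one_mul]

instance isFiniteMeasure_condLaw {X : Type*} [MeasurableSpace X] (μ : Measure X) {i m n : ℕ}
    (P : Measure (Fin n → X)) (h : i + m = n) (y : Fin i → X) :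
    IsFiniteMeasure (condLaw μ P h y) := by
  constructor
  rw [condLaw, Measure.smul_apply, withDensity_apply _ MeasurableSet.univ, Measure.restrict_univ,
    smul_eq_mul]
  exact lt_of_le_of_lt (ENNReal.inv_mul_le_one _) ENNReal.one_lt_top

/-- The law of the last `l` terms of the sequence, conditioned on its first `i` terms being `y`
(`k` terms in between are skipped). -/
def condLawTail {X : Type*} [MeasurableSpace X] (μ : Measure X) {i k l m n : ℕ}
    (P : Measure (Fin n → X)) (h : i + m = n) (h' : k + l = m) (y : Fin i → X) :
    Measure (Fin l → X) :=
  (condLaw μ P h y).map (finalPart h')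

instance isFiniteMeasure_condLawTail {X : Type*} [MeasurableSpace X] (μ : Measure X)
    {i k l m n : ℕ} (P : Measure (Fin n → X)) (h : i + m = n) (h' : k + l = m) (y : Fin i → X) :
    IsFiniteMeasure (condLawTail μ P h h' y) := by
  unfold condLawTail; infer_instance

/-- The total variation norm of a signed measure, with the factor `1/2` that is customary
in probability. -/
def tvNorm {Y : Type*} [MeasurableSpace Y] (τ : SignedMeasure Y) : ℝ :=
  (τ.totalVariation Set.univ).toReal / 2

/-- `η_{ij}(y, w, w')`, the total variation distance of the laws of `(X_j, …, X_n)` conditioned on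
`(X_1, …, X_i) = y w` and on `(X_1, …, X_i) = y w'`. Terms are numbered from `0` by `Fin n`, so
that `y` consists of the `i.val` terms before the one with index `i`. -/
def eta {X : Type*} [MeasurableSpace X] (μ : Measure X) {n : ℕ} (P : Measure (Fin n → X))
    (i j : Fin n) (hij : i < j) (y : Fin i.val → X) (w w' : X) : ℝ :=
  have h : (i.val + 1) + (n - (i.val + 1)) = n := by omega
  have h' : (j.val - (i.val + 1)) + (n - j.val) = n - (i.val + 1) := by omega
  tvNorm ((condLawTail μ P h h' (Fin.snoc (α := fun _ => X) y w)).toSignedMeasure -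
    (condLawTail μ P h h' (Fin.snoc (α := fun _ => X) y w')).toSignedMeasure)

/-- The essential supremum of `η_{ij}(y, w, w')` with respect to the law of `(X_1, …, X_i)`: the
least `a ≥ 0` such that `η_{ij}(y, w, w') ≤ a` whenever `y w` and `y w'` avoid some null set. -/
def etaBar {X : Type*} [MeasurableSpace X] (μ : Measure X) {n : ℕ} (P : Measure (Fin n → X))
    (i j : Fin n) (hij : i < j) : ℝ :=
  have h : (i.val + 1) + (n - (i.val + 1)) = n := by omega
  sInf {a : ℝ | 0 ≤ a ∧ ∃ N : Set (Fin (i.val + 1) → X), (P.map (initialPart h)) N = 0 ∧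
    ∀ (y : Fin i.val → X) (w w' : X), Fin.snoc (α := fun _ => X) y w ∉ N →
      Fin.snoc (α := fun _ => X) y w' ∉ N → eta μ P i j hij y w w' ≤ a}

/-- The `η`-mixing matrix `Δ_n`. -/
def mixingMatrix {X : Type*} [MeasurableSpace X] (μ : Measure X) {n : ℕ}
    (P : Measure (Fin n → X)) : Matrix (Fin n) (Fin n) ℝ :=
  fun i j => if hij : i < j then etaBar μ P i j hij else if i = j then 1 else 0

/-- The `ℓ_∞` operator norm of a matrix (the maximal absolute row sum). -/
def opNormInfty {n : ℕ} (A : Matrix (Fin n) (Fin n) ℝ) : ℝ :=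
  letI : NormedAddCommGroup (Matrix (Fin n) (Fin n) ℝ) := Matrix.linftyOpNormedAddCommGroup
  ‖A‖

/-- A sequence of measures `P n` on `X^n`, `n ≥ 1`, is `η`-mixing if `sup_n ‖Δ_n‖_∞ < ∞`. -/
def IsEtaMixing {X : Type*} [MeasurableSpace X] (μ : Measure X)
    (P : ∀ n : ℕ+, Measure (Fin n → X)) : Prop :=
  BddAbove (Set.range fun n => opNormInfty (mixingMatrix μ (P n)))

/-! ### `Ψ`-dominance -/

/-- The marginal projection, which integrates out the first variable. -/
def marginal {X : Type*} [MeasurableSpace X] (μ : Measure X) {n : ℕ}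
    (f : (Fin (n + 1) → X) → ℝ) : (Fin n → X) → ℝ :=
  fun x => ∫ z, f (Fin.cons (α := fun _ => X) z x) ∂μ

/-- The functional `Ψ_n`. -/
def Psi {X : Type*} [MeasurableSpace X] (μ : Measure X) : (n : ℕ) → ((Fin n → X) → ℝ) → ℝ
  | 0, _ => 0
  | n + 1, f => (∫ x, max (f x) 0 ∂(prodMeasure μ (n + 1))) + Psi μ n (marginal μ f)

/-- `f` is Lipschitz with constant `K` for the metric `ρ`. -/
def IsLip {Y : Type*} (ρ : MetricSpace Y) (K : ℝ≥0) (f : Y → ℝ) : Prop :=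
  letI := ρ
  LipschitzWith K f

/-- The diameter of a metric space, possibly infinite. -/
def diameter {Y : Type*} (ρ : MetricSpace Y) : ℝ≥0∞ :=
  letI := ρ
  Metric.ediam (Set.univ : Set Y)

/-- The Lipschitz constant of `f`: the smallest `K` for which `f` is `K`-Lipschitz. -/
def lipConst {Y : Type*} (ρ : MetricSpace Y) (f : Y → ℝ) : ℝ≥0 :=
  sInf {K : ℝ≥0 | IsLip ρ K f}

/-- The set of `1`-Lipschitz functions with values in `[0, diam]`. -/
def LipSet {Y : Type*} (ρ : MetricSpace Y) : Set (Y → ℝ) :=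
  {g | IsLip ρ 1 g ∧ ∀ x, 0 ≤ g x ∧ ENNReal.ofReal (g x) ≤ diameter ρ}

/-- Consistency of the family of metrics `ρ_k` on `X^k`, `1 ≤ k ≤ N`: deleting a common coordinate
does not change the distance, and the product `σ`-algebra of `X^k`, on which product measures
live, is the Borel `σ`-algebra of `ρ_k`. -/
structure IsConsistent {X : Type*} [MeasurableSpace X] (ρ : ∀ k : ℕ, MetricSpace (Fin k → X))
    (N : ℕ∞) : Prop where
  dist_removeNth : ∀ k : ℕ, ((k + 1 : ℕ) : ℕ∞) ≤ N → ∀ (i : Fin (k + 1))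
    (x y : Fin (k + 1) → X), x i = y i →
    (ρ (k + 1)).dist x y = (ρ k).dist (i.removeNth x) (i.removeNth y)
  borel : ∀ k : ℕ, 1 ≤ k → (k : ℕ∞) ≤ N →
    (MeasurableSpace.pi : MeasurableSpace (Fin k → X)) =
      @borel (Fin k → X) (ρ k).toUniformSpace.toTopologicalSpace

/-- The family `(X^k, ρ_k)`, `1 ≤ k ≤ N` (`N = ⊤` for an infinite family), is `Ψ`-dominated with
respect to `μ`. -/
structure IsPsiDominated {X : Type*} [MeasurableSpace X] (ρ : ∀ k : ℕ, MetricSpace (Fin k → X))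
    (μ : Measure X) (N : ℕ∞) : Prop where
  consistent : IsConsistent ρ N
  le_psi : ∀ k : ℕ, 1 ≤ k → (k : ℕ∞) ≤ N → ∀ f : (Fin k → X) → ℝ,
    Integrable f (prodMeasure μ k) → ∀ g ∈ LipSet (ρ k),
      ∫ x, f x * g x ∂(prodMeasure μ k) ≤ Psi μ k f

/-! ### Concentration and Lévy families -/

/-- The metric `c • ρ`. -/
@[reducible] def scaledMetric {Y : Type*} (ρ : MetricSpace Y) (c : ℝ) (hc : 0 < c) :
    MetricSpace Y where
  dist x y := c * ρ.dist x y
  dist_self x := by simp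
  dist_comm x y := by rw [ρ.dist_comm]
  dist_triangle x y z := by
    rw [← mul_add]; exact mul_le_mul_of_nonneg_left (ρ.dist_triangle x y z) hc.le
  eq_of_dist_eq_zero {x y} h :=
    ρ.eq_of_dist_eq_zero ((mul_eq_zero.1 h).resolve_left hc.ne')

/-- The normalized metric `ρ_n / n` on `X^n`. -/
@[reducible] def normalizedMetric {X : Type*} (ρ : ∀ k : ℕ, MetricSpace (Fin k → X)) (n : ℕ+) :
    MetricSpace (Fin n → X) :=
  scaledMetric (ρ n) (1 / (n : ℝ)) (by have := n.pos; positivity)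

/-- The closed fattening `{x | ρ(x, A) ≤ t}` of a (nonempty) set `A`. -/
def fattening {Y : Type*} (ρ : MetricSpace Y) (A : Set Y) (t : ℝ) : Set Y :=
  letI := ρ
  {x | Metric.infDist x A ≤ t}

/-- The concentration function `α(t) = 1 - inf {P(A_t) : P(A) ≥ 1/2}`. -/
def concentrationFunction {Y : Type*} [MeasurableSpace Y] (ρ : MetricSpace Y) (P : Measure Y)
    (t : ℝ) : ℝ :=
  1 - sInf {r : ℝ | ∃ A : Set Y, MeasurableSet A ∧ 1 / 2 ≤ P.real A ∧ r = P.real (fattening ρ A t)}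

/-- Normal Lévy families of metric probability spaces of finite diameter. -/
def IsNormalLevyFamily {Y : ℕ+ → Type*} [∀ n, MeasurableSpace (Y n)] (ρ : ∀ n, MetricSpace (Y n))
    (P : ∀ n, Measure (Y n)) : Prop :=
  (∀ n, diameter (ρ n) < ⊤) ∧
    ∃ c₁ c₂ : ℝ, 0 < c₁ ∧ 0 < c₂ ∧ ∀ (n : ℕ+) (t : ℝ), 0 < t →
      concentrationFunction (ρ n) (P n) t ≤ c₁ * Real.exp (-c₂ * n * t ^ 2)

end

/-!
The proof is the method of bounded martingale differences. Let `f` be `1`-Lipschitz for `ρ_n`, and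
let `F_i` be its conditional mean given the first `i` terms (`condMean`), so that `F_0 = E f` and
`F_n = f` almost surely. If `|F_{i+1} - F_i| ≤ c` almost surely for all `i`, then
`E exp (s f) ≤ exp (n c² s² / 2) exp (s E f)`: on `[-c, c]` the exponential lies below an affine
function, whose linear term contributes nothing since `F_{i+1} - F_i` is orthogonal to functions
of the first `i` terms (`integral_exp_le_of_orthogonal`). Chernoff's bound then gives the deviation
inequality.

The bound with `c = ‖Δ_n‖_∞` is where `Ψ`-dominance enters
(`IsPsiDominated.ae_abs_condMean_sub_le`). By the tower property
`F_i(y) = ∫ F_{i+1}(y w') dK_y(w')`, where `K_y` is the law of the next term given `y`, so it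
suffices to bound `F_{i+1}(y w) - F_{i+1}(y w')` for almost all pairs. This difference is the sum
of two terms.

* The change of the argument of `f` from `y w z` to `y w' z` costs at most `ρ_1(w, w')`, by
  consistency of the metrics. Testing `Ψ`-dominance on the set where `ρ_k(·, x₀) > k` shows that
  this set is null (`IsPsiDominated.ae_dist_le`); so `ρ_1(w, w') ≤ 1` for almost every `w'`. For
  the same reason `X^k` has diameter at most `2 k`, and Lipschitz functions are bounded.
* The change of the law of the remaining `m` terms `z`: up to a constant, `z ↦ f(y w' z)` belongs
  to `LipSet (ρ m)`, so `Ψ`-dominance bounds the difference of its means by `Ψ_m` of the difference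
  of the two densities. The `l`-th term of `Ψ_m` is the integral of the positive part of the
  difference of the marginal densities of the last `l` terms, which is the total variation
  distance of their laws (`Psi_le_sum_tvNorm`), that is, one of the `η_{ij}(y, w, w')`.

Adding up gives `1 + ∑_{j > i} \bar η_{ij}`, a row sum of `Δ_n`. The normal Lévy property follows
on applying the deviation inequality to the distance from a set of measure at least `1/2`.
-/

/-! ### Exponential moments of bounded martingale differences -/

/-- One step of the Azuma–Hoeffding argument. The orthogonality hypothesis is the only trace of
the martingale property that is needed, because `exp (l * ·)` is dominated on `[-c, c]` by an
affine function. -/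
lemma integral_exp_le_of_orthogonal {Ω : Type*} [MeasurableSpace Ω] {P : Measure Ω}
    [IsProbabilityMeasure P] {U V : Ω → ℝ} (hU : Measurable U) (hV : Measurable V) {C c l : ℝ}
    (hc : 0 < c) (hUC : ∀ x, |U x| ≤ C) (hVC : ∀ x, |V x| ≤ C)
    (hd : ∀ᵐ x ∂P, |V x - U x| ≤ c)
    (horth : ∫ x, Real.exp (l * U x) * V x ∂P = ∫ x, Real.exp (l * U x) * U x ∂P) :
    ∫ x, Real.exp (l * V x) ∂P ≤ Real.exp (l ^ 2 * c ^ 2 / 2) * ∫ x, Real.exp (l * U x) ∂P := by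
  have hexp : ∀ W : Ω → ℝ, (∀ x, |W x| ≤ C) → ∀ x, ‖Real.exp (l * W x)‖ ≤ Real.exp (|l| * C) := by
    intro W hW x
    rw [Real.norm_eq_abs, Real.abs_exp]
    refine Real.exp_le_exp.2 ((le_abs_self _).trans ?_)
    rw [abs_mul]
    exact mul_le_mul_of_nonneg_left (hW x) (abs_nonneg _)
  have hint : ∀ W : Ω → ℝ, Measurable W → (∀ x, |W x| ≤ C) →
      Integrable (fun x => Real.exp (l * W x)) P := fun W hWm hW =>
    Integrable.of_bound (hWm.const_mul l).exp.aestronglyMeasurable _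
      (Filter.Eventually.of_forall (hexp W hW))
  have hintm : ∀ W : Ω → ℝ, Measurable W → (∀ x, |W x| ≤ C) →
      Integrable (fun x => Real.exp (l * U x) * W x) P := fun W hWm hW =>
    (hint U hU hUC).mul_bdd (c := C) hWm.aestronglyMeasurable
      (Filter.Eventually.of_forall fun x => by simpa using hW x)
  have hpt : ∀ᵐ x ∂P, Real.exp (l * V x) ≤ Real.exp (l * U x) * Real.cosh (l * c) +
      (Real.exp (l * U x) * V x - Real.exp (l * U x) * U x) * (Real.sinh (l * c) / c) := by
    filter_upwards [hd] with x hx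
    have h1 : |(V x - U x) / c| ≤ 1 := by
      rw [abs_div, abs_of_pos hc]
      exact (div_le_one hc).2 hx
    have h2 := Real.exp_mul_le_cosh_add_mul_sinh h1 (l * c)
    have h3 : Real.exp (l * V x) = Real.exp (l * U x) * Real.exp ((V x - U x) / c * (l * c)) := by
      rw [← Real.exp_add]
      congr 1
      field_simp
      ring
    rw [h3]
    refine (mul_le_mul_of_nonneg_left h2 (Real.exp_pos _).le).trans (le_of_eq ?_)
    field_simp
  have hsub : Integrable (fun x => (Real.exp (l * U x) * V x - Real.exp (l * U x) * U x) *
      (Real.sinh (l * c) / c)) P := ((hintm V hV hVC).sub (hintm U hU hUC)).mul_const _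
  refine (integral_mono_ae (hint V hV hVC)
    (((hint U hU hUC).mul_const (Real.cosh (l * c))).add hsub) hpt).trans ?_
  rw [integral_add' ((hint U hU hUC).mul_const _) hsub, integral_mul_const,
    integral_mul_const, integral_sub (hintm V hV hVC) (hintm U hU hUC), horth, sub_self,
    zero_mul, add_zero, mul_comm]
  refine mul_le_mul_of_nonneg_right ?_ (integral_nonneg fun x => (Real.exp_pos _).le)
  refine (Real.cosh_le_exp_half_sq _).trans (le_of_eq ?_)
  rw [mul_pow]

/-- Chernoff's bound for a bounded function whose exponential moments are those of a Gaussian with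
variance `v`. -/
lemma measureReal_deviation_le_of_integral_exp_le {Ω : Type*} [MeasurableSpace Ω] {P : Measure Ω}
    [IsProbabilityMeasure P] {f : Ω → ℝ} (hf : Measurable f) {C e v t : ℝ} (hC : ∀ x, |f x| ≤ C)
    (hv : 0 < v)
    (hmgf : ∀ l : ℝ, ∫ x, Real.exp (l * f x) ∂P ≤ Real.exp (l ^ 2 * v / 2) * Real.exp (l * e))
    (ht : 0 < t) :
    P.real {x | t < |f x - e|} ≤ 2 * Real.exp (-(t ^ 2 / (2 * v))) := by
  have hside : ∀ s : ℝ, s ^ 2 = 1 →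
      P.real {x | t < s * (f x - e)} ≤ Real.exp (-(t ^ 2 / (2 * v))) := by
    intro s hs
    have hint : Integrable (fun x => Real.exp (t / v * s * f x)) P := by
      refine Integrable.of_bound (C := Real.exp (|t / v * s| * C))
        (hf.const_mul _).exp.aestronglyMeasurable (Filter.Eventually.of_forall fun x => ?_)
      rw [Real.norm_eq_abs, Real.abs_exp]
      refine Real.exp_le_exp.2 ((le_abs_self _).trans ?_)
      rw [abs_mul]
      exact mul_le_mul_of_nonneg_left (hC x) (abs_nonneg _)
    have hmarkov := mul_meas_ge_le_integral_of_nonneg (μ := P)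
      (f := fun x => Real.exp (t / v * s * f x))
      (Filter.Eventually.of_forall fun x => (Real.exp_pos _).le) hint
      (Real.exp (t / v * (t + s * e)))
    have hsub : P.real {x | t < s * (f x - e)} ≤
        P.real {x | Real.exp (t / v * (t + s * e)) ≤ Real.exp (t / v * s * f x)} := by
      refine measureReal_mono fun x hx => ?_
      simp only [Set.mem_ofPred_eq] at hx ⊢
      refine Real.exp_le_exp.2 ?_
      rw [mul_assoc]
      exact mul_le_mul_of_nonneg_left (by linarith) (by positivity)
    refine hsub.trans ?_
    have h1 := hmarkov.trans (hmgf (t / v * s))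
    rw [← Real.exp_add] at h1
    rw [← mul_le_mul_iff_right₀ (Real.exp_pos (t / v * (t + s * e))), ← Real.exp_add]
    refine h1.trans (le_of_eq ?_)
    congr 1
    rw [mul_pow, hs]
    field_simp
    ring
  have hU : {x | t < |f x - e|} ⊆ {x | t < 1 * (f x - e)} ∪ {x | t < -1 * (f x - e)} := by
    intro x hx
    simp only [Set.mem_ofPred_eq, lt_abs, Set.mem_union] at hx ⊢
    rcases hx with hx | hx
    · left; linarith
    · right; linarith
  refine (measureReal_mono hU).trans ((measureReal_union_le _ _).trans ?_)
  linarith [hside 1 (by norm_num), hside (-1) (by norm_num)]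

/-! ### Conditional means -/

lemma concat_initialPart_finalPart {X : Type*} {i m n : ℕ} (h : i + m = n) (x : Fin n → X) :
    concat h (initialPart h x) (finalPart h x) = x := by
  subst h
  funext k
  refine Fin.addCases (fun a => ?_) (fun a => ?_) k <;> simp [concat, initialPart, finalPart]

lemma condLaw_absolutelyContinuous {X : Type*} [MeasurableSpace X] (μ : Measure X) {i m n : ℕ}
    (P : Measure (Fin n → X)) (h : i + m = n) (y : Fin i → X) :
    condLaw μ P h y ≪ prodMeasure μ m :=
  (withDensity_absolutelyContinuous _ _).smul_left _

lemma condLaw_univ_le_one {X : Type*} [MeasurableSpace X] (μ : Measure X) {i m n : ℕ}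
    (P : Measure (Fin n → X)) (h : i + m = n) (y : Fin i → X) :
    condLaw μ P h y Set.univ ≤ 1 := by
  rw [condLaw, Measure.smul_apply, withDensity_apply _ MeasurableSet.univ, Measure.restrict_univ,
    smul_eq_mul]
  exact ENNReal.inv_mul_le_one _

lemma measurable_condLaw {X : Type*} [MeasurableSpace X] (μ : Measure X) [SigmaFinite μ]
    {i m n : ℕ} (P : Measure (Fin n → X)) (h : i + m = n) : Measurable (condLaw μ P h) := by
  have hp : Measurable (P.rnDeriv (prodMeasure μ n)) := Measure.measurable_rnDeriv _ _
  refine Measure.measurable_of_measurable_coe _ fun s hs => ?_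
  simp only [condLaw, Measure.smul_apply, withDensity_apply _ hs, smul_eq_mul]
  have h2 : Measurable fun q : (Fin i → X) × (Fin m → X) =>
      P.rnDeriv (prodMeasure μ n) (concat h q.1 q.2) := hp.comp (measurable_concat h)
  exact h2.lintegral_prod_right'.inv.mul (Measurable.lintegral_prod_right' h2)

/-- The conditional laws, as a kernel. -/
noncomputable def condKernel {X : Type*} [MeasurableSpace X] (μ : Measure X) [SigmaFinite μ]
    {i m n : ℕ} (P : Measure (Fin n → X)) (h : i + m = n) :
    ProbabilityTheory.Kernel (Fin i → X) (Fin m → X) :=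
  ⟨condLaw μ P h, measurable_condLaw μ P h⟩

lemma condKernel_apply {X : Type*} [MeasurableSpace X] (μ : Measure X) [SigmaFinite μ]
    {i m n : ℕ} (P : Measure (Fin n → X)) (h : i + m = n) (y : Fin i → X) :
    condKernel μ P h y = condLaw μ P h y := rfl

instance isFiniteKernel_condKernel {X : Type*} [MeasurableSpace X] (μ : Measure X) [SigmaFinite μ]
    {i m n : ℕ} (P : Measure (Fin n → X)) (h : i + m = n) :
    ProbabilityTheory.IsFiniteKernel (condKernel μ P h) :=
  ⟨1, ENNReal.one_lt_top, condLaw_univ_le_one μ P h⟩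

open ProbabilityTheory in
/-- Disintegration, in terms of the composition-product of a measure and a kernel. -/
lemma map_concat_compProd {X : Type*} [MeasurableSpace X] (μ : Measure X) [SigmaFinite μ]
    {i m n : ℕ} (P : Measure (Fin n → X)) [IsProbabilityMeasure P] (hP : P ≪ prodMeasure μ n)
    (h : i + m = n) :
    (P.map (initialPart h) ⊗ₘ condKernel μ P h).map (fun q => concat h q.1 q.2) = P := by
  ext s hs
  have hc := measurable_concat (X := X) h
  rw [Measure.map_apply hc hs, Measure.compProd_apply (hc hs), ← lintegral_indicator_one hs,
    lintegral_condLaw μ P hP h (measurable_one.indicator hs)]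
  refine lintegral_congr fun y => ?_
  have hsy : MeasurableSet ((fun z => concat h y z) ⁻¹' s) := measurable_concat_right h y hs
  rw [condKernel_apply]
  exact ((lintegral_indicator_one hsy).symm : _)

lemma integral_eq_integral_condLaw {X : Type*} [MeasurableSpace X] (μ : Measure X) [SigmaFinite μ]
    {i m n : ℕ} (P : Measure (Fin n → X)) [IsProbabilityMeasure P] (hP : P ≪ prodMeasure μ n)
    (h : i + m = n) {f : (Fin n → X) → ℝ} (hf : Integrable f P) :
    ∫ x, f x ∂P
      = ∫ y, ∫ z, f (concat h y z) ∂(condLaw μ P h y) ∂(P.map (initialPart h)) := by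
  have hc := measurable_concat (X := X) h
  have := Measure.isProbabilityMeasure_map (μ := P) (measurable_initialPart h).aemeasurable
  rw [← map_concat_compProd μ P hP h] at hf
  conv_lhs => rw [← map_concat_compProd μ P hP h]
  rw [integral_map hc.aemeasurable hf.1]
  exact Measure.integral_compProd ((integrable_map_measure hf.1 hc.aemeasurable).1 hf)

open ProbabilityTheory in
lemma ae_condLaw_of_ae {X : Type*} [MeasurableSpace X] (μ : Measure X) [SigmaFinite μ]
    {i m n : ℕ} (P : Measure (Fin n → X)) [IsProbabilityMeasure P] (hP : P ≪ prodMeasure μ n)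
    (h : i + m = n) {Q : (Fin n → X) → Prop} (hQ : ∀ᵐ x ∂P, Q x) :
    ∀ᵐ y ∂(P.map (initialPart h)), ∀ᵐ z ∂(condLaw μ P h y), Q (concat h y z) := by
  have hc := measurable_concat (X := X) h
  have := Measure.isProbabilityMeasure_map (μ := P) (measurable_initialPart h).aemeasurable
  have hQ' : ∀ᵐ q ∂(P.map (initialPart h) ⊗ₘ condKernel μ P h), Q (concat h q.1 q.2) :=
    ae_of_ae_map (p := Q) hc.aemeasurable (by rwa [map_concat_compProd μ P hP h])
  have h3 := Measure.ae_ae_of_ae_compProd hQ'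
  simpa only [condKernel_apply] using h3

/-- The total mass of `condLaw` is at most `1`, and its mean is `1`. -/
lemma ae_isProbabilityMeasure_condLaw {X : Type*} [MeasurableSpace X] (μ : Measure X)
    [SigmaFinite μ] {i m n : ℕ} (P : Measure (Fin n → X)) [IsProbabilityMeasure P]
    (hP : P ≪ prodMeasure μ n) (h : i + m = n) :
    ∀ᵐ y ∂(P.map (initialPart h)), IsProbabilityMeasure (condLaw μ P h y) := by
  have := Measure.isProbabilityMeasure_map (μ := P) (measurable_initialPart h).aemeasurable
  have hmass := lintegral_condLaw μ P hP h (F := fun _ => 1) measurable_const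
  simp only [lintegral_one, measure_univ] at hmass
  have hle : (fun y => condLaw μ P h y Set.univ) ≤ᵐ[P.map (initialPart h)] fun _ => 1 :=
    Filter.Eventually.of_forall (condLaw_univ_le_one μ P h)
  have hfin : ∫⁻ y, condLaw μ P h y Set.univ ∂(P.map (initialPart h)) ≠ ⊤ :=
    hmass ▸ ENNReal.one_ne_top
  have hone : ∫⁻ _, 1 ∂(P.map (initialPart h)) ≤
      ∫⁻ y, condLaw μ P h y Set.univ ∂(P.map (initialPart h)) := by
    rw [← hmass, lintegral_one, measure_univ]
  filter_upwards [ae_eq_of_ae_le_of_lintegral_le hle hfin aemeasurable_const hone] with y hy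
  exact ⟨hy⟩

/-- The conditional mean of `f` given that the first `i` terms are `y`. -/
noncomputable def condMean {X : Type*} [MeasurableSpace X] (μ : Measure X) {i m n : ℕ}
    (P : Measure (Fin n → X)) (h : i + m = n) (f : (Fin n → X) → ℝ) (y : Fin i → X) : ℝ :=
  ∫ z, f (concat h y z) ∂(condLaw μ P h y)

lemma measurable_condMean {X : Type*} [MeasurableSpace X] (μ : Measure X) [SigmaFinite μ]
    {i m n : ℕ} (P : Measure (Fin n → X)) (h : i + m = n) {f : (Fin n → X) → ℝ}
    (hf : Measurable f) : Measurable (condMean μ P h f) :=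
  (StronglyMeasurable.integral_kernel_prod_right (κ := condKernel μ P h)
    (f := fun y z => f (concat h y z))
    (hf.comp (measurable_concat h)).stronglyMeasurable).measurable

lemma abs_condMean_le {X : Type*} [MeasurableSpace X] (μ : Measure X) {i m n : ℕ}
    (P : Measure (Fin n → X)) (h : i + m = n) {f : (Fin n → X) → ℝ} {C : ℝ} (h0 : 0 ≤ C)
    (hC : ∀ x, |f x| ≤ C) (y : Fin i → X) : |condMean μ P h f y| ≤ C := by
  have h1 : ‖condMean μ P h f y‖ ≤ C * (condLaw μ P h y).real Set.univ :=
    norm_integral_le_of_norm_le_const (Filter.Eventually.of_forall fun z => hC _)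
  have h2 : (condLaw μ P h y).real Set.univ ≤ 1 :=
    ENNReal.toReal_le_of_le_ofReal zero_le_one (by simpa using condLaw_univ_le_one μ P h y)
  exact h1.trans (mul_le_of_le_one_right h0 h2)

/-- The defining property of a conditional mean. -/
lemma integral_mul_eq_integral_mul_condMean {X : Type*} [MeasurableSpace X] (μ : Measure X)
    [SigmaFinite μ] {i m n : ℕ} (P : Measure (Fin n → X)) [IsProbabilityMeasure P]
    (hP : P ≪ prodMeasure μ n) (h : i + m = n) {f : (Fin n → X) → ℝ} (hf : Measurable f) {C : ℝ}
    (hC : ∀ x, |f x| ≤ C) {G : (Fin i → X) → ℝ} (hG : Measurable G) {D : ℝ}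
    (hD : ∀ y, |G y| ≤ D) :
    ∫ x, G (initialPart h x) * f x ∂P
      = ∫ y, G y * condMean μ P h f y ∂(P.map (initialPart h)) := by
  have hGi : Measurable fun x : Fin n → X => G (initialPart h x) :=
    hG.comp (measurable_initialPart h)
  have hint : Integrable (fun x => G (initialPart h x) * f x) P :=
    (Integrable.of_bound hGi.aestronglyMeasurable D
      (Filter.Eventually.of_forall fun x => hD _)).mul_bdd (c := C) hf.aestronglyMeasurable
      (Filter.Eventually.of_forall hC)
  rw [integral_eq_integral_condLaw μ P hP h hint]
  refine integral_congr_ae (Filter.Eventually.of_forall fun y => ?_)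
  simp only [initialPart_concat]
  rw [integral_const_mul, condMean]

lemma map_initialPart_absolutelyContinuous {X : Type*} [MeasurableSpace X] {μ : Measure X}
    [SigmaFinite μ] {i m n : ℕ} {P : Measure (Fin n → X)} (hP : P ≪ prodMeasure μ n)
    (h : i + m = n) : P.map (initialPart h) ≪ prodMeasure μ i := by
  refine (hP.map (measurable_initialPart h)).trans ?_
  rw [← map_concat μ h, Measure.map_map (measurable_initialPart h) (measurable_concat h)]
  have : (initialPart h ∘ fun q : (Fin i → X) × (Fin m → X) => concat h q.1 q.2) = Prod.fst := by
    funext q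
    exact initialPart_concat h q.1 q.2
  rw [this]
  exact Measure.quasiMeasurePreserving_fst.absolutelyContinuous

/-- The tower property: the conditional mean given `i` terms is the conditional mean, under the
law of the first `i + 1` terms, of the conditional mean given `i + 1` terms. -/
lemma condMean_ae_eq_condMean_condMean {X : Type*} [MeasurableSpace X] (μ : Measure X)
    [SigmaFinite μ] {i m l n : ℕ} (P : Measure (Fin n → X)) [IsProbabilityMeasure P]
    (hP : P ≪ prodMeasure μ n) (h : i + l = n) (h' : i + 1 + m = n) {f : (Fin n → X) → ℝ}
    (hf : Measurable f) {C : ℝ} (h0 : 0 ≤ C) (hC : ∀ x, |f x| ≤ C) :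
    condMean μ P h f =ᵐ[P.map (initialPart h)]
      condMean μ (P.map (initialPart h')) (rfl : i + 1 = i + 1) (condMean μ P h' f) := by
  have := Measure.isProbabilityMeasure_map (μ := P) (measurable_initialPart h).aemeasurable
  have := Measure.isProbabilityMeasure_map (μ := P) (measurable_initialPart h').aemeasurable
  have hm := measurable_condMean μ P h hf
  have hm' := measurable_condMean μ P h' hf
  have hmm := measurable_condMean μ (P.map (initialPart h')) (rfl : i + 1 = i + 1) hm'
  have hb' := abs_condMean_le μ P h' h0 hC
  have hmap : (P.map (initialPart h')).map (initialPart (rfl : i + 1 = i + 1))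
      = P.map (initialPart h) := by
    rw [Measure.map_map (measurable_initialPart _) (measurable_initialPart _)]
    rfl
  refine Integrable.ae_eq_of_forall_setIntegral_eq _ _
    (Integrable.of_bound hm.aestronglyMeasurable C
      (Filter.Eventually.of_forall (abs_condMean_le μ P h h0 hC)))
    (Integrable.of_bound hmm.aestronglyMeasurable C
      (Filter.Eventually.of_forall (abs_condMean_le μ _ _ h0 hb'))) fun s hs _ => ?_
  set G : (Fin i → X) → ℝ := s.indicator 1 with hG
  have hGm : Measurable G := measurable_one.indicator hs
  have hGb : ∀ y, |G y| ≤ 1 := fun y => by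
    by_cases hy : y ∈ s <;> simp [hG, hy]
  have hind : ∀ F : (Fin i → X) → ℝ,
      ∫ y in s, F y ∂(P.map (initialPart h)) = ∫ y, G y * F y ∂(P.map (initialPart h)) := by
    intro F
    rw [← integral_indicator hs]
    refine integral_congr_ae (Filter.Eventually.of_forall fun y => ?_)
    by_cases hy : y ∈ s <;> simp [hG, hy]
  rw [hind, hind, ← integral_mul_eq_integral_mul_condMean μ P hP h hf hC hGm hGb]
  have h2 := integral_mul_eq_integral_mul_condMean μ (P.map (initialPart h'))
    (map_initialPart_absolutelyContinuous hP h') (rfl : i + 1 = i + 1) hm' hb' hGm hGb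
  rw [hmap] at h2
  rw [← h2]
  exact integral_mul_eq_integral_mul_condMean μ P hP h' hf hC
    (hGm.comp (measurable_initialPart (rfl : i + 1 = i + 1))) (fun y => hGb _)

/-! ### Estimates of `Ψ` -/

lemma measurePreserving_cons {X : Type*} [MeasurableSpace X] (μ : Measure X) [SigmaFinite μ]
    (n : ℕ) : MeasurePreserving (fun q : X × (Fin n → X) => Fin.cons (α := fun _ => X) q.1 q.2)
      (μ.prod (prodMeasure μ n)) (prodMeasure μ (n + 1)) := by
  have h := (measurePreserving_piFinSuccAbove (fun _ : Fin (n + 1) => μ) 0).symm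
  convert! h using 1
  funext q
  simp [MeasurableEquiv.piFinSuccAbove, Fin.insertNthEquiv]

lemma integrable_cons {X : Type*} [MeasurableSpace X] {μ : Measure X} [SigmaFinite μ] {n : ℕ}
    {f : (Fin (n + 1) → X) → ℝ} (hf : Integrable f (prodMeasure μ (n + 1))) :
    Integrable (fun q : X × (Fin n → X) => f (Fin.cons (α := fun _ => X) q.1 q.2))
      (μ.prod (prodMeasure μ n)) :=
  (measurePreserving_cons μ n).integrable_comp_of_integrable hf

lemma integrable_marginal {X : Type*} [MeasurableSpace X] {μ : Measure X} [SigmaFinite μ] {n : ℕ}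
    {f : (Fin (n + 1) → X) → ℝ} (hf : Integrable f (prodMeasure μ (n + 1))) :
    Integrable (marginal μ f) (prodMeasure μ n) :=
  (integrable_cons hf).integral_prod_right

lemma measurable_marginal {X : Type*} [MeasurableSpace X] (μ : Measure X) [SigmaFinite μ] {n : ℕ}
    {f : (Fin (n + 1) → X) → ℝ} (hf : Measurable f) : Measurable (marginal μ f) := by
  have hc : Measurable fun q : X × (Fin n → X) => f (Fin.cons (α := fun _ => X) q.1 q.2) :=
    hf.comp (measurePreserving_cons μ n).measurable
  exact (StronglyMeasurable.integral_prod_left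
    (f := fun z x => f (Fin.cons (α := fun _ => X) z x)) hc.stronglyMeasurable).measurable

lemma integral_eq_integral_marginal {X : Type*} [MeasurableSpace X] {μ : Measure X} [SigmaFinite μ]
    {n : ℕ} {f : (Fin (n + 1) → X) → ℝ} (hf : Integrable f (prodMeasure μ (n + 1))) :
    ∫ x, f x ∂(prodMeasure μ (n + 1)) = ∫ y, marginal μ f y ∂(prodMeasure μ n) := by
  have hc := measurePreserving_cons μ n
  rw [← hc.map_eq, integral_map hc.measurable.aemeasurable (by rw [hc.map_eq]; exact hf.1)]
  exact integral_prod_symm _ (integrable_cons hf)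

lemma measurable_tail {X : Type*} [MeasurableSpace X] (n : ℕ) :
    Measurable (Fin.tail : (Fin (n + 1) → X) → (Fin n → X)) :=
  measurable_pi_lambda _ fun _ => measurable_pi_apply _

lemma setIntegral_marginal {X : Type*} [MeasurableSpace X] {μ : Measure X} [SigmaFinite μ]
    {n : ℕ} {f : (Fin (n + 1) → X) → ℝ} (hf : Integrable f (prodMeasure μ (n + 1)))
    {A : Set (Fin n → X)} (hA : MeasurableSet A) :
    ∫ y in A, marginal μ f y ∂(prodMeasure μ n)
      = ∫ x in Fin.tail ⁻¹' A, f x ∂(prodMeasure μ (n + 1)) := by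
  have hA' : MeasurableSet ((Fin.tail : (Fin (n + 1) → X) → (Fin n → X)) ⁻¹' A) :=
    measurable_tail n hA
  rw [← integral_indicator hA, ← integral_indicator hA',
    integral_eq_integral_marginal (hf.indicator hA')]
  refine integral_congr_ae (Filter.Eventually.of_forall fun y => ?_)
  by_cases hy : y ∈ A <;> simp [marginal, Set.indicator, hy]

lemma integral_abs_marginal_le {X : Type*} [MeasurableSpace X] {μ : Measure X} [SigmaFinite μ]
    {n : ℕ} {f : (Fin (n + 1) → X) → ℝ} (hf : Integrable f (prodMeasure μ (n + 1))) :
    ∫ y, |marginal μ f y| ∂(prodMeasure μ n) ≤ ∫ x, |f x| ∂(prodMeasure μ (n + 1)) := by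
  rw [integral_eq_integral_marginal hf.abs]
  exact integral_mono (integrable_marginal hf).abs (integrable_marginal hf.abs)
    fun y => abs_integral_le_integral_abs

lemma Psi_le_nat_mul_integral_abs {X : Type*} [MeasurableSpace X] (μ : Measure X) [SigmaFinite μ]
    (n : ℕ) {f : (Fin n → X) → ℝ} (hf : Integrable f (prodMeasure μ n)) :
    Psi μ n f ≤ n * ∫ x, |f x| ∂(prodMeasure μ n) := by
  induction n with
  | zero => simp [Psi]
  | succ n ih =>
    have h1 : ∫ x, max (f x) 0 ∂(prodMeasure μ (n + 1)) ≤ ∫ x, |f x| ∂(prodMeasure μ (n + 1)) :=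
      integral_mono hf.pos_part hf.abs fun x => max_le (le_abs_self _) (abs_nonneg _)
    have h2 := ih (integrable_marginal hf)
    have h3 := mul_le_mul_of_nonneg_left (integral_abs_marginal_le hf) (Nat.cast_nonneg (α := ℝ) n)
    rw [Psi]
    push_cast
    linarith

/-- A signed measure of total mass zero is at most its total variation norm, halved as in
probability, on every set. -/
lemma apply_le_tvNorm {Y : Type*} [MeasurableSpace Y] (τ : SignedMeasure Y) (hτ : τ Set.univ = 0)
    (A : Set Y) : τ A ≤ tvNorm τ := by
  have huniv := τ.apply_eq_posPart_real_sub_negPart_real MeasurableSet.univ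
  have hsum : (τ.totalVariation Set.univ).toReal =
      τ.toJordanDecomposition.posPart.real Set.univ
        + τ.toJordanDecomposition.negPart.real Set.univ := by
    rw [SignedMeasure.totalVariation, ← measureReal_def, measureReal_add_apply]
  have hle : τ A ≤ τ.toJordanDecomposition.posPart.real Set.univ := by
    by_cases hA : MeasurableSet A
    · rw [τ.apply_eq_posPart_real_sub_negPart_real hA]
      have h1 : τ.toJordanDecomposition.posPart.real A ≤
        τ.toJordanDecomposition.posPart.real Set.univ := measureReal_mono (Set.subset_univ _)
      have h2 := measureReal_nonneg (μ := τ.toJordanDecomposition.negPart) (s := A)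
      linarith
    · rw [τ.not_measurable hA]
      exact measureReal_nonneg
  rw [tvNorm, hsum]
  linarith

/-- If the signed measure `τ` has total mass zero and density `f`, then the terms of `Ψ_m(f)` are
bounded by the total variation norms of the laws of the final parts under `τ`: the law of the last
`l` terms has as density the iterated marginal of `f`. -/
lemma Psi_le_sum_tvNorm {X : Type*} [MeasurableSpace X] (μ : Measure X) [SigmaFinite μ]
    (m : ℕ) {f : (Fin m → X) → ℝ} (hfm : Measurable f) (hf : Integrable f (prodMeasure μ m))
    (τ : SignedMeasure (Fin m → X)) (hτ : τ Set.univ = 0)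
    (hfτ : ∀ A, MeasurableSet A → ∫ x in A, f x ∂(prodMeasure μ m) = τ A) (b : ℕ → ℝ)
    (hb : ∀ (k l : ℕ) (h : k + l = m), 1 ≤ l → tvNorm (τ.map (finalPart h)) ≤ b k) :
    Psi μ m f ≤ ∑ k ∈ Finset.range m, b k := by
  induction m generalizing b with
  | zero => simp [Psi]
  | succ m ih =>
    have hpos : ∫ x, max (f x) 0 ∂(prodMeasure μ (m + 1)) ≤ b 0 := by
      have hA : MeasurableSet {x | 0 < f x} := measurableSet_lt measurable_const hfm
      have h1 : ∫ x, max (f x) 0 ∂(prodMeasure μ (m + 1)) = τ {x | 0 < f x} := by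
        rw [← hfτ _ hA, ← integral_indicator hA]
        refine integral_congr_ae (Filter.Eventually.of_forall fun x => ?_)
        by_cases hx : 0 < f x
        · simp [Set.indicator, hx, hx.le]
        · simp [Set.indicator, hx, not_lt.1 hx]
      have h2 : τ.map (finalPart (Nat.zero_add (m + 1))) = τ := by
        have : (finalPart (Nat.zero_add (m + 1)) : (Fin (m + 1) → X) → (Fin (m + 1) → X)) = id := by
          funext x k
          simp [finalPart]
        rw [this, VectorMeasure.map_id]
      rw [h1]
      refine (apply_le_tvNorm τ hτ _).trans ?_
      have := hb 0 (m + 1) (Nat.zero_add _) (by omega)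
      rwa [h2] at this
    have htail := measurable_tail (X := X) m
    have hrec := ih (measurable_marginal μ hfm) (integrable_marginal hf) (τ.map Fin.tail)
      (by rw [VectorMeasure.map_apply _ htail MeasurableSet.univ]; exact hτ)
      (fun A hA => by
        rw [setIntegral_marginal hf hA, hfτ _ (htail hA), VectorMeasure.map_apply _ htail hA])
      (fun k => b (k + 1))
      (fun k l h hl => by
        have h' : k + 1 + l = m + 1 := by omega
        have hmap : (τ.map Fin.tail).map (finalPart h) = τ.map (finalPart h') := by
          ext A hA
          have hm : Measurable (finalPart h : (Fin m → X) → (Fin l → X)) := measurable_finalPart h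
          rw [VectorMeasure.map_apply _ hm hA, VectorMeasure.map_apply _ htail (hm hA),
            VectorMeasure.map_apply _ (measurable_finalPart h') hA]
          congr 1
          ext x
          have : finalPart h (Fin.tail x) = finalPart h' x := by
            funext a
            simp only [finalPart, Fin.tail]
            congr 1
            ext
            simp
            omega
          simp [this]
        rw [hmap]
        exact hb (k + 1) l h' hl)
    rw [Psi, Finset.sum_range_succ']
    linarith

/-! ### Consequences of `Ψ`-dominance -/

lemma IsConsistent.measurable {X : Type*} [MeasurableSpace X] {ρ : ∀ k : ℕ, MetricSpace (Fin k → X)}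
    {N : ℕ∞} (hρ : IsConsistent ρ N) {n : ℕ} (hn : 1 ≤ n) (hnN : (n : ℕ∞) ≤ N)
    {f : (Fin n → X) → ℝ} {K : ℝ≥0} (hf : IsLip (ρ n) K f) : Measurable f := by
  let _ := ρ n
  have : BorelSpace (Fin n → X) := ⟨hρ.borel n hn hnN⟩
  exact (show LipschitzWith K f from hf).continuous.measurable

lemma isLip_dist {Y : Type*} (ρ : MetricSpace Y) (y : Y) : IsLip ρ 1 fun x => ρ.dist x y := by
  let _ := ρ
  exact LipschitzWith.dist_left y

lemma isLip_iff_le_add {Y : Type*} {ρ : MetricSpace Y} {K : ℝ≥0} {f : Y → ℝ} :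
    IsLip ρ K f ↔ ∀ x y, f x ≤ f y + K * ρ.dist x y := by
  let _ := ρ
  exact ⟨fun h => LipschitzWith.le_add_mul h, fun h => LipschitzWith.of_le_add_mul K h⟩

/-- Testing `Ψ`-dominance on the sets where the distance exceeds `k`: the distance from any given
point is at most `k` almost everywhere. -/
lemma IsPsiDominated.ae_dist_le {X : Type*} [MeasurableSpace X] {μ : Measure X} [SigmaFinite μ]
    {ρ : ∀ k : ℕ, MetricSpace (Fin k → X)} {N : ℕ∞} (hρ : IsPsiDominated ρ μ N) {k : ℕ}
    (hk : 1 ≤ k) (hkN : (k : ℕ∞) ≤ N) (x₀ : Fin k → X) :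
    ∀ᵐ x ∂(prodMeasure μ k), (ρ k).dist x x₀ ≤ k := by
  set g : (Fin k → X) → ℝ := fun x => (ρ k).dist x x₀ with hg
  have hgl : IsLip (ρ k) 1 g := isLip_dist (ρ k) x₀
  have hgm : Measurable g := hρ.consistent.measurable hk hkN hgl
  have hg0 : ∀ x, 0 ≤ g x := fun x => @dist_nonneg _ (ρ k).toPseudoMetricSpace x x₀
  have hgL : g ∈ LipSet (ρ k) := by
    refine ⟨hgl, fun x => ⟨hg0 x, ?_⟩⟩
    let _ := ρ k
    change ENNReal.ofReal (dist x x₀) ≤ Metric.ediam Set.univ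
    rw [← edist_dist]
    exact Metric.edist_le_ediam_of_mem (Set.mem_univ _) (Set.mem_univ _)
  -- The truncation makes both the test function and its product with `g` integrable.
  have hnull : ∀ j : ℕ, prodMeasure μ k ({x | (k : ℝ) < g x ∧ g x ≤ j} ∩
      spanningSets (prodMeasure μ k) j) = 0 := by
    intro j
    set A := {x | (k : ℝ) < g x ∧ g x ≤ j} ∩ spanningSets (prodMeasure μ k) j with hA
    have hAm : MeasurableSet A := ((measurableSet_lt measurable_const hgm).inter
      (measurableSet_le hgm measurable_const)).inter (measurableSet_spanningSets _ _)
    have hAfin : prodMeasure μ k A ≠ ⊤ :=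
      ((measure_mono Set.inter_subset_right).trans_lt (measure_spanningSets_lt_top _ j)).ne
    have hint1 : Integrable (A.indicator fun _ => (1 : ℝ)) (prodMeasure μ k) :=
      (integrable_indicator_iff hAm).2 (integrableOn_const hAfin)
    have hint2 : IntegrableOn g A (prodMeasure μ k) := by
      refine Measure.integrableOn_of_bounded (M := j) hAfin hgm.aestronglyMeasurable
        ((ae_restrict_iff' hAm).2 (Filter.Eventually.of_forall fun x hx => ?_))
      rw [Real.norm_eq_abs, abs_of_nonneg (hg0 x)]
      exact hx.1.2
    have h1 := hρ.le_psi k hk hkN _ hint1 g hgL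
    have h2 := Psi_le_nat_mul_integral_abs μ k hint1
    have h3 : ∫ x, A.indicator (fun _ => (1 : ℝ)) x * g x ∂(prodMeasure μ k)
        = ∫ x in A, g x ∂(prodMeasure μ k) := by
      rw [← integral_indicator hAm]
      refine integral_congr_ae (Filter.Eventually.of_forall fun x => ?_)
      by_cases hx : x ∈ A <;> simp [hx]
    have h4 : ∫ x, |A.indicator (fun _ => (1 : ℝ)) x| ∂(prodMeasure μ k)
        = (prodMeasure μ k).real A := by
      rw [← integral_indicator_one hAm]
      refine integral_congr_ae (Filter.Eventually.of_forall fun x => ?_)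
      by_cases hx : x ∈ A <;> simp [hx]
    have h5 : ∫ x in A, (g x - k) ∂(prodMeasure μ k) ≤ 0 := by
      rw [integral_sub hint2 (integrableOn_const hAfin), setIntegral_const, smul_eq_mul]
      rw [h3] at h1
      rw [h4] at h2
      linarith
    by_contra hpos
    have hint3 : IntegrableOn (fun x => g x - k) A (prodMeasure μ k) :=
      hint2.sub (integrableOn_const hAfin)
    have h6 : 0 < ∫ x in A, (g x - k) ∂(prodMeasure μ k) := by
      rw [setIntegral_pos_iff_support_of_nonneg_ae
        ((ae_restrict_iff' hAm).2 (Filter.Eventually.of_forall fun x hx => ?_))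
        hint3]
      · refine (pos_iff_ne_zero.2 hpos).trans_le (measure_mono fun x hx => ⟨?_, hx⟩)
        exact (sub_pos.2 hx.1.1).ne'
      · exact (sub_pos.2 hx.1.1).le
    linarith
  rw [ae_iff]
  refine measure_mono_null (fun x hx => ?_) (measure_iUnion_null hnull)
  obtain ⟨j₁, hj₁⟩ := exists_nat_ge (g x)
  set j₂ := spanningSetsIndex (prodMeasure μ k) x
  refine Set.mem_iUnion.2 ⟨max j₁ j₂, ⟨not_le.1 hx, hj₁.trans (by exact_mod_cast le_max_left _ _)⟩,
    monotone_spanningSets _ (le_max_right _ _) (mem_spanningSetsIndex _ x)⟩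

lemma IsPsiDominated.dist_le {X : Type*} [MeasurableSpace X] {μ : Measure X} [SigmaFinite μ]
    {ρ : ∀ k : ℕ, MetricSpace (Fin k → X)} {N : ℕ∞} (hρ : IsPsiDominated ρ μ N) {k : ℕ}
    (hk : 1 ≤ k) (hkN : (k : ℕ∞) ≤ N) (hμ : prodMeasure μ k ≠ 0) (x y : Fin k → X) :
    (ρ k).dist x y ≤ 2 * k := by
  have : NeZero (prodMeasure μ k) := ⟨hμ⟩
  obtain ⟨z, hz⟩ := ((hρ.ae_dist_le hk hkN x).and (hρ.ae_dist_le hk hkN y)).exists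
  have h1 := (ρ k).dist_triangle x z y
  rw [(ρ k).dist_comm x z] at h1
  linarith [hz.1, hz.2]

lemma IsConsistent.dist_concat_left {X : Type*} [MeasurableSpace X]
    {ρ : ∀ k : ℕ, MetricSpace (Fin k → X)} {N : ℕ∞} (hρ : IsConsistent ρ N) {i m n : ℕ}
    (h : i + m = n) (hn : (n : ℕ∞) ≤ N) (y : Fin i → X) (z z' : Fin m → X) :
    (ρ n).dist (concat h y z) (concat h y z') = (ρ m).dist z z' := by
  induction i generalizing n with
  | zero =>
    obtain rfl : m = n := by omega
    have : ∀ z : Fin m → X, concat h y z = z := fun z => by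
      funext k
      simp [concat, Fin.append_left_nil]
    rw [this, this]
  | succ i ih =>
    obtain rfl : n = i + m + 1 := by omega
    have hrem : ∀ z : Fin m → X, (0 : Fin (i + m + 1)).removeNth (concat h y z)
        = concat rfl (Fin.tail y) z := fun z => by
      funext k
      refine Fin.addCases (fun a => ?_) (fun a => ?_) k
      · have : Fin.cast h.symm (Fin.castAdd m a).succ = Fin.castAdd m a.succ := by ext; simp
        simp [Fin.removeNth, concat, this, Fin.tail]
      · have : Fin.cast h.symm (Fin.natAdd i a).succ = Fin.natAdd (i + 1) a := by
          ext; simp; omega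
        simp [Fin.removeNth, concat, this]
    have hzero : ∀ z : Fin m → X, concat h y z 0 = y 0 := fun z => by
      have : Fin.cast h.symm (0 : Fin (i + m + 1)) = Fin.castAdd m (0 : Fin (i + 1)) := by
        ext; simp
      rw [concat, this, Fin.append_left]
    rw [hρ.dist_removeNth (i + m) hn 0 _ _ ((hzero z).trans (hzero z').symm), hrem, hrem]
    exact ih rfl (le_trans (by exact_mod_cast Nat.le_succ _) hn) (Fin.tail y)

lemma IsConsistent.dist_concat_right {X : Type*} [MeasurableSpace X]
    {ρ : ∀ k : ℕ, MetricSpace (Fin k → X)} {N : ℕ∞} (hρ : IsConsistent ρ N) {i m n : ℕ}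
    (h : i + m = n) (hn : (n : ℕ∞) ≤ N) (y y' : Fin i → X) (z : Fin m → X) :
    (ρ n).dist (concat h y z) (concat h y' z) = (ρ i).dist y y' := by
  induction m generalizing n with
  | zero =>
    obtain rfl : i = n := by omega
    have : ∀ y : Fin i → X, concat h y z = y := fun y => by
      funext k
      simp [concat, Fin.append_right_nil]
    rw [this, this]
  | succ m ih =>
    subst h
    have hrem : ∀ y : Fin i → X, (Fin.last (i + m)).removeNth
        (concat (rfl : i + (m + 1) = i + m + 1) y z)
        = concat rfl y (Fin.init z) := fun y => by
      funext k
      refine Fin.addCases (fun a => ?_) (fun a => ?_) k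
      · have : (Fin.castAdd m a).castSucc = Fin.castAdd (m + 1) a := rfl
        simp [Fin.removeNth, concat, this]
      · have : (Fin.natAdd i a).castSucc = Fin.natAdd i a.castSucc := rfl
        simp [Fin.removeNth, concat, this, Fin.init]
    have hlast : ∀ y : Fin i → X, concat (rfl : i + (m + 1) = i + m + 1) y z (Fin.last (i + m))
        = z (Fin.last m) := fun y => Fin.append_right y z (Fin.last m)
    rw [hρ.dist_removeNth (i + m) hn (Fin.last _) _ _ ((hlast y).trans (hlast y').symm), hrem, hrem]
    exact ih rfl (le_trans (by exact_mod_cast Nat.le_succ _) hn) (Fin.init z)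

/-- The means of a `1`-Lipschitz function under two laws differ by at most the sum of the total
variation distances of the laws of the final parts. Subtracting a constant from the function puts
it into `LipSet`, and changes neither side. -/
lemma IsPsiDominated.integral_sub_integral_le {X : Type*} [MeasurableSpace X] {μ : Measure X}
    [SigmaFinite μ] {ρ : ∀ k : ℕ, MetricSpace (Fin k → X)} {N : ℕ∞} (hρ : IsPsiDominated ρ μ N)
    {m : ℕ} (hmN : (m : ℕ∞) ≤ N) {ν ν' : Measure (Fin m → X)} [IsProbabilityMeasure ν]
    [IsProbabilityMeasure ν'] (hν : ν ≪ prodMeasure μ m) (hν' : ν' ≪ prodMeasure μ m)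
    {g : (Fin m → X) → ℝ} (hg : IsLip (ρ m) 1 g) {b : ℕ → ℝ}
    (hb : ∀ (k l : ℕ) (h : k + l = m), 1 ≤ l →
      tvNorm ((ν.map (finalPart h)).toSignedMeasure - (ν'.map (finalPart h)).toSignedMeasure)
        ≤ b k) :
    ∫ x, g x ∂ν - ∫ x, g x ∂ν' ≤ ∑ k ∈ Finset.range m, b k := by
  rcases Nat.eq_zero_or_pos m with rfl | hm
  · simp [integral_unique]
  have hμ0 : prodMeasure μ m ≠ 0 := by
    intro h0
    rw [h0] at hν
    exact IsProbabilityMeasure.ne_zero ν (Measure.absolutelyContinuous_zero_iff.1 hν)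
  have hd := hρ.dist_le hm hmN hμ0
  have hgm : Measurable g := hρ.consistent.measurable hm hmN hg
  obtain ⟨x₀⟩ : Nonempty (Fin m → X) := nonempty_of_isProbabilityMeasure ν
  have hle : ∀ x y, g x ≤ g y + (ρ m).dist x y := fun x y => by
    simpa using isLip_iff_le_add.1 hg x y
  have hbdd : BddBelow (Set.range g) := by
    refine ⟨g x₀ - 2 * m, ?_⟩
    rintro _ ⟨x, rfl⟩
    linarith [hle x₀ x, hd x₀ x]
  set a := sInf (Set.range g) with ha
  have hag : ∀ x, a ≤ g x := fun x => csInf_le hbdd ⟨x, rfl⟩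
  have hga : ∀ x, g x - a ≤ 2 * m := fun x => by
    have : g x - 2 * m ≤ a := by
      refine le_csInf ⟨g x₀, x₀, rfl⟩ ?_
      rintro _ ⟨y, rfl⟩
      linarith [hle x y, hd x y]
    linarith
  have hgL : (fun x => g x - a) ∈ LipSet (ρ m) := by
    refine ⟨isLip_iff_le_add.2 fun x y => ?_, fun x => ⟨sub_nonneg.2 (hag x), ?_⟩⟩
    · simp only [NNReal.coe_one, one_mul]
      linarith [hle x y]
    let _ := ρ m
    have hfin : diameter (ρ m) ≠ ⊤ := by
      refine ne_top_of_le_ne_top (ENNReal.ofReal_ne_top (r := 2 * m)) (Metric.ediam_le ?_)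
      intro y _ z _
      rw [edist_dist]
      exact ENNReal.ofReal_le_ofReal (hd y z)
    have hdiam : ∀ y z, (ρ m).dist y z ≤ (diameter (ρ m)).toReal := fun y z => by
      rw [← ENNReal.ofReal_le_iff_le_toReal hfin]
      refine le_trans (le_of_eq (edist_dist y z).symm) ?_
      exact Metric.edist_le_ediam_of_mem (Set.mem_univ _) (Set.mem_univ _)
    rw [ENNReal.ofReal_le_iff_le_toReal hfin]
    have : g x - (diameter (ρ m)).toReal ≤ a := by
      refine le_csInf ⟨g x₀, x₀, rfl⟩ ?_
      rintro _ ⟨y, rfl⟩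
      linarith [hle x y, hdiam x y]
    linarith
  have hgb : ∀ x, |g x - a| ≤ 2 * m := fun x => by
    rw [abs_of_nonneg (sub_nonneg.2 (hag x))]
    exact hga x
  have hint : ∀ κ : Measure (Fin m → X), IsProbabilityMeasure κ → Integrable g κ := fun κ _ => by
    have h1 : Integrable (fun x => g x - a) κ :=
      Integrable.of_bound (hgm.sub_const a).aestronglyMeasurable _ (Filter.Eventually.of_forall hgb)
    refine (h1.add (integrable_const a)).congr (Filter.Eventually.of_forall fun x => ?_)
    simp
  set r : (Fin m → X) → ℝ := fun x => (ν.rnDeriv (prodMeasure μ m) x).toReal with hr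
  set r' : (Fin m → X) → ℝ := fun x => (ν'.rnDeriv (prodMeasure μ m) x).toReal with hr'
  have hri : Integrable r (prodMeasure μ m) := Measure.integrable_toReal_rnDeriv
  have hri' : Integrable r' (prodMeasure μ m) := Measure.integrable_toReal_rnDeriv
  have hmul : ∀ s, Integrable s (prodMeasure μ m) →
      Integrable (fun x => s x * (g x - a)) (prodMeasure μ m) := fun s hs =>
    hs.mul_bdd (c := 2 * m) (hgm.sub_const a).aestronglyMeasurable
      (Filter.Eventually.of_forall hgb)
  have hrm : Measurable r := (Measure.measurable_rnDeriv _ _).ennreal_toReal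
  have hrm' : Measurable r' := (Measure.measurable_rnDeriv _ _).ennreal_toReal
  have hpsi := hρ.le_psi m hm hmN (fun x => r x - r' x) (hri.sub hri') _ hgL
  have heq : ∫ x, (r x - r' x) * (g x - a) ∂(prodMeasure μ m) = ∫ x, g x ∂ν - ∫ x, g x ∂ν' := by
    have h1 : ∫ x, r x * (g x - a) ∂(prodMeasure μ m) = ∫ x, (g x - a) ∂ν :=
      integral_rnDeriv_smul hν
    have h2 : ∫ x, r' x * (g x - a) ∂(prodMeasure μ m) = ∫ x, (g x - a) ∂ν' :=
      integral_rnDeriv_smul hν'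
    simp_rw [sub_mul]
    rw [integral_sub (hmul r hri) (hmul r' hri'), h1, h2,
      integral_sub (hint ν inferInstance) (integrable_const _),
      integral_sub (hint ν' inferInstance) (integrable_const _)]
    simp
  rw [heq] at hpsi
  refine hpsi.trans (Psi_le_sum_tvNorm μ m (hrm.sub hrm') (hri.sub hri')
    (ν.toSignedMeasure - ν'.toSignedMeasure) ?_ (fun A hA => ?_) b fun k l h hl => ?_)
  · simp [Measure.toSignedMeasure_sub_apply MeasurableSet.univ]
  · rw [Measure.toSignedMeasure_sub_apply hA]
    simp only [Pi.sub_apply]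
    rw [integral_sub hri.integrableOn hri'.integrableOn, hr, hr',
      Measure.setIntegral_toReal_rnDeriv hν, Measure.setIntegral_toReal_rnDeriv hν']
  · have hmap : (ν.toSignedMeasure - ν'.toSignedMeasure).map (finalPart h)
        = (ν.map (finalPart h)).toSignedMeasure - (ν'.map (finalPart h)).toSignedMeasure := by
      ext A hA
      have hfp : Measurable (finalPart h : (Fin m → X) → (Fin l → X)) := measurable_finalPart h
      rw [VectorMeasure.map_apply _ hfp hA, Measure.toSignedMeasure_sub_apply (hfp hA),
        Measure.toSignedMeasure_sub_apply hA, map_measureReal_apply hfp hA,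
        map_measureReal_apply hfp hA]
    rw [hmap]
    exact hb k l h hl

/-! ### The mixing coefficients -/

lemma tvNorm_sub_le_one {Y : Type*} [MeasurableSpace Y] (ν ν' : Measure Y) [IsFiniteMeasure ν]
    [IsFiniteMeasure ν'] (hν : ν Set.univ ≤ 1) (hν' : ν' Set.univ ≤ 1) :
    tvNorm (ν.toSignedMeasure - ν'.toSignedMeasure) ≤ 1 := by
  set τ := ν.toSignedMeasure - ν'.toSignedMeasure with hτ
  obtain ⟨S, hS, -, -, hp, hn⟩ := τ.toJordanDecomposition.exists_compl_positive_negative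
  have hone : ∀ κ : Measure Y, κ Set.univ ≤ 1 → ∀ A, κ.real A ≤ 1 := fun κ hκ A =>
    ENNReal.toReal_le_of_le_ofReal zero_le_one
      (by simpa using (measure_mono (Set.subset_univ A)).trans hκ)
  have happ : ∀ A, MeasurableSet A → τ.toJordanDecomposition.posPart.real A
      - τ.toJordanDecomposition.negPart.real A = ν.real A - ν'.real A := fun A hA => by
    rw [← τ.apply_eq_posPart_real_sub_negPart_real hA, hτ, Measure.toSignedMeasure_sub_apply hA]
  have hp' : τ.toJordanDecomposition.posPart.real S = 0 := by simp [measureReal_def, hp]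
  have hn' : τ.toJordanDecomposition.negPart.real Sᶜ = 0 := by simp [measureReal_def, hn]
  have hsplit : ∀ κ : Measure Y, IsFiniteMeasure κ → κ.real Set.univ = κ.real S + κ.real Sᶜ :=
    fun κ _ => (measureReal_add_measureReal_compl hS).symm
  have h1 := happ S hS
  have h2 := happ Sᶜ hS.compl
  rw [tvNorm, SignedMeasure.totalVariation, ← measureReal_def, measureReal_add_apply,
    hsplit τ.toJordanDecomposition.posPart inferInstance,
    hsplit τ.toJordanDecomposition.negPart inferInstance]
  linarith [hone ν hν Sᶜ, hone ν' hν' S, measureReal_nonneg (μ := ν') (s := Sᶜ),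
    measureReal_nonneg (μ := ν) (s := S)]

lemma eta_le_one {X : Type*} [MeasurableSpace X] (μ : Measure X) {n : ℕ}
    (P : Measure (Fin n → X)) (i j : Fin n) (hij : i < j) (y : Fin i.val → X) (w w' : X) :
    eta μ P i j hij y w w' ≤ 1 := by
  have hle : ∀ {i k l m : ℕ} (h : i + m = n) (h' : k + l = m) (y : Fin i → X),
      condLawTail μ P h h' y Set.univ ≤ 1 := fun h h' y => by
    rw [condLawTail, Measure.map_apply (measurable_finalPart h') MeasurableSet.univ]
    exact condLaw_univ_le_one μ P h y
  exact tvNorm_sub_le_one _ _ (hle _ _ _) (hle _ _ _)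

lemma etaBar_nonneg {X : Type*} [MeasurableSpace X] (μ : Measure X) {n : ℕ}
    (P : Measure (Fin n → X)) (i j : Fin n) (hij : i < j) : 0 ≤ etaBar μ P i j hij :=
  Real.sInf_nonneg fun _ ha => ha.1

/-- The infimum that defines `etaBar` is attained. -/
lemma exists_null_eta_le_etaBar {X : Type*} [MeasurableSpace X] (μ : Measure X) {n : ℕ}
    (P : Measure (Fin n → X)) (i j : Fin n) (hij : i < j)
    (h : i.val + 1 + (n - (i.val + 1)) = n) :
    ∃ N : Set (Fin (i.val + 1) → X), (P.map (initialPart h)) N = 0 ∧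
      ∀ (y : Fin i.val → X) (w w' : X), Fin.snoc (α := fun _ => X) y w ∉ N →
        Fin.snoc (α := fun _ => X) y w' ∉ N → eta μ P i j hij y w w' ≤ etaBar μ P i j hij := by
  set S : Set ℝ := {a : ℝ | 0 ≤ a ∧ ∃ N : Set (Fin (i.val + 1) → X),
    (P.map (initialPart h)) N = 0 ∧
    ∀ (y : Fin i.val → X) (w w' : X), Fin.snoc (α := fun _ => X) y w ∉ N →
      Fin.snoc (α := fun _ => X) y w' ∉ N → eta μ P i j hij y w w' ≤ a} with hS
  have hdef : etaBar μ P i j hij = sInf S := rfl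
  have hne : S.Nonempty :=
    ⟨1, zero_le_one, ∅, measure_empty, fun y w w' _ _ => eta_le_one μ P i j hij y w w'⟩
  have hex : ∀ k : ℕ, ∃ N : Set (Fin (i.val + 1) → X), (P.map (initialPart h)) N = 0 ∧
      ∀ (y : Fin i.val → X) (w w' : X), Fin.snoc (α := fun _ => X) y w ∉ N →
        Fin.snoc (α := fun _ => X) y w' ∉ N →
          eta μ P i j hij y w w' ≤ etaBar μ P i j hij + 1 / ((k : ℝ) + 1) := by
    intro k
    obtain ⟨a, ⟨_, N, hN, hle⟩, ha⟩ := exists_lt_of_csInf_lt hne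
      (lt_add_of_pos_right (sInf S) (Nat.one_div_pos_of_nat (α := ℝ) (n := k)))
    exact ⟨N, hN, fun y w w' hw hw' => (hle y w w' hw hw').trans (hdef ▸ ha.le)⟩
  choose N hN hle using hex
  refine ⟨⋃ k, N k, measure_iUnion_null hN, fun y w w' hw hw' => ?_⟩
  rw [Set.mem_iUnion, not_exists] at hw hw'
  refine le_of_forall_pos_le_add fun ε hε => ?_
  obtain ⟨k, hk⟩ := exists_nat_one_div_lt hε
  linarith [hle k y w w' (hw k) (hw' k)]

lemma tvNorm_condLawTail_eq_eta {X : Type*} [MeasurableSpace X] (μ : Measure X) {n : ℕ}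
    (P : Measure (Fin n → X)) {i j : Fin n} (hij : i < j) {k l : ℕ}
    (h : i.val + 1 + (n - (i.val + 1)) = n) (h' : k + l = n - (i.val + 1))
    (hk : k = j.val - (i.val + 1)) (y : Fin i.val → X) (w w' : X) :
    tvNorm ((condLawTail μ P h h' (Fin.snoc (α := fun _ => X) y w)).toSignedMeasure -
      (condLawTail μ P h h' (Fin.snoc (α := fun _ => X) y w')).toSignedMeasure)
      = eta μ P i j hij y w w' := by
  have hij' : i.val < j.val := hij
  obtain rfl : l = n - j.val := by omega
  subst hk
  rfl

/-- `\bar η_{i, i + 1 + k}`, with the value `0` when there is no term `i + 1 + k`. -/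
noncomputable def etaBarShift {X : Type*} [MeasurableSpace X] (μ : Measure X) {n : ℕ}
    (P : Measure (Fin n → X)) (i : Fin n) (k : ℕ) : ℝ :=
  if hk : i.val + 1 + k < n then
    etaBar μ P i ⟨i.val + 1 + k, hk⟩ (Fin.lt_def.2 (by simp only; omega)) else 0

lemma sum_row_le_opNormInfty {n : ℕ} (A : Matrix (Fin n) (Fin n) ℝ) (i : Fin n) :
    ∑ j, A i j ≤ opNormInfty A := by
  have h1 : (∑ j, ‖A i j‖₊ : ℝ≥0) ≤ Finset.univ.sup fun i => ∑ j, ‖A i j‖₊ :=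
    Finset.le_sup (f := fun i => ∑ j, ‖A i j‖₊) (Finset.mem_univ i)
  rw [opNormInfty, Matrix.linfty_opNorm_def]
  refine le_trans ?_ (NNReal.coe_le_coe.2 h1)
  rw [NNReal.coe_sum]
  exact Finset.sum_le_sum fun j _ => Real.le_norm_self _

lemma mixingMatrix_nonneg {X : Type*} [MeasurableSpace X] (μ : Measure X) {n : ℕ}
    (P : Measure (Fin n → X)) (i j : Fin n) : 0 ≤ mixingMatrix μ P i j := by
  unfold mixingMatrix
  split_ifs with h1 h2
  · exact etaBar_nonneg μ P i j h1
  · exact zero_le_one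
  · exact le_rfl

lemma one_add_sum_etaBarShift_le {X : Type*} [MeasurableSpace X] (μ : Measure X) {n : ℕ}
    (P : Measure (Fin n → X)) (i : Fin n) :
    1 + ∑ k ∈ Finset.range (n - (i.val + 1)), etaBarShift μ P i k
      ≤ opNormInfty (mixingMatrix μ P) := by
  refine le_trans ?_ (sum_row_le_opNormInfty _ i)
  set c : ℕ → ℝ := fun j => if h : j < n then mixingMatrix μ P i ⟨j, h⟩ else 0 with hc
  have hc0 : ∀ j, 0 ≤ c j := fun j => by
    simp only [hc]
    split_ifs
    · exact mixingMatrix_nonneg μ P _ _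
    · exact le_rfl
  have h1 : ∑ j, mixingMatrix μ P i j = ∑ j ∈ Finset.range n, c j := by
    rw [Finset.sum_range]
    exact Finset.sum_congr rfl fun j _ => by simp [hc]
  have h2 : ∑ j ∈ Finset.range n, c j = ∑ j ∈ Finset.range (i.val + 1), c j
      + ∑ k ∈ Finset.range (n - (i.val + 1)), c (i.val + 1 + k) := by
    rw [← Finset.sum_range_add, Nat.add_sub_cancel' i.isLt]
  have h3 : 1 ≤ ∑ j ∈ Finset.range (i.val + 1), c j := by
    have : c i.val = 1 := by simp [hc, mixingMatrix]
    rw [Finset.sum_range_succ, this]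
    linarith [Finset.sum_nonneg fun j (_ : j ∈ Finset.range i.val) => hc0 j]
  have h4 : ∀ k, c (i.val + 1 + k) = etaBarShift μ P i k := fun k => by
    simp only [hc, etaBarShift]
    by_cases hk : i.val + 1 + k < n
    · rw [dif_pos hk, dif_pos hk, mixingMatrix, dif_pos]
    · rw [dif_neg hk, dif_neg hk]
  rw [h1, h2, Finset.sum_congr rfl fun k _ => h4 k]
  linarith

lemma one_le_opNormInfty_mixingMatrix {X : Type*} [MeasurableSpace X] (μ : Measure X) {n : ℕ}
    (hn : 1 ≤ n) (P : Measure (Fin n → X)) : 1 ≤ opNormInfty (mixingMatrix μ P) := by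
  have h1 := one_add_sum_etaBarShift_le μ P ⟨0, hn⟩
  have h2 : 0 ≤ ∑ k ∈ Finset.range (n - (0 + 1)), etaBarShift μ P ⟨0, hn⟩ k :=
    Finset.sum_nonneg fun k _ => by
      unfold etaBarShift
      split_ifs
      · exact etaBar_nonneg μ P _ _ _
      · exact le_rfl
  exact le_trans (by linarith) h1

/-! ### Martingale differences of Lipschitz functions -/

/-- Changing the last conditioning term from `w'` to `w` alters the conditional mean of a
`1`-Lipschitz function in two ways: through the function itself, by at most `ρ_1(w, w')`, and
through the law of the remaining terms. -/
lemma IsPsiDominated.condMean_sub_condMean_le {X : Type*} [MeasurableSpace X] {μ : Measure X}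
    [SigmaFinite μ] {ρ : ∀ k : ℕ, MetricSpace (Fin k → X)} {N : ℕ∞} (hρ : IsPsiDominated ρ μ N)
    {i m n : ℕ} (hnN : (n : ℕ∞) ≤ N) (P : Measure (Fin n → X)) (h : i + 1 + m = n)
    {f : (Fin n → X) → ℝ} (hf : IsLip (ρ n) 1 f) {C : ℝ} (hC : ∀ x, |f x| ≤ C)
    (y : Fin i → X) (w w' : Fin 1 → X)
    (hw : IsProbabilityMeasure (condLaw μ P h (concat rfl y w)))
    (hw' : IsProbabilityMeasure (condLaw μ P h (concat rfl y w'))) {b : ℕ → ℝ}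
    (hb : ∀ (k l : ℕ) (h' : k + l = m), 1 ≤ l →
      tvNorm ((condLawTail μ P h h' (concat rfl y w)).toSignedMeasure -
        (condLawTail μ P h h' (concat rfl y w')).toSignedMeasure) ≤ b k) :
    condMean μ P h f (concat rfl y w) - condMean μ P h f (concat rfl y w')
      ≤ (ρ 1).dist w w' + ∑ k ∈ Finset.range m, b k := by
  have hmN : (m : ℕ∞) ≤ N := le_trans (by exact_mod_cast (by omega : m ≤ n)) hnN
  have hiN : ((i + 1 : ℕ) : ℕ∞) ≤ N := le_trans (by exact_mod_cast (by omega : i + 1 ≤ n)) hnN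
  have hle : ∀ x y, f x ≤ f y + (ρ n).dist x y := fun x y => by
    simpa using isLip_iff_le_add.1 hf x y
  have hfm : Measurable f := hρ.consistent.measurable (by omega) hnN hf
  have hint : ∀ a, Integrable (fun z => f (concat h a z)) (condLaw μ P h (concat rfl y w)) :=
    fun a => Integrable.of_bound (hfm.comp (measurable_concat_right h a)).aestronglyMeasurable C
      (Filter.Eventually.of_forall fun z => hC _)
  have h1 : condMean μ P h f (concat rfl y w) ≤
      ∫ z, f (concat h (concat rfl y w') z) ∂(condLaw μ P h (concat rfl y w))
        + (ρ 1).dist w w' := by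
    have h2 : ∫ z, (f (concat h (concat rfl y w') z) + (ρ 1).dist w w')
        ∂(condLaw μ P h (concat rfl y w))
        = ∫ z, f (concat h (concat rfl y w') z) ∂(condLaw μ P h (concat rfl y w))
          + (ρ 1).dist w w' := by
      rw [integral_add (hint _) (integrable_const _)]
      simp
    rw [← h2]
    refine integral_mono (hint _) ((hint _).add (integrable_const _)) fun z => ?_
    refine (hle _ (concat h (concat rfl y w') z)).trans (le_of_eq ?_)
    rw [hρ.consistent.dist_concat_right h hnN, hρ.consistent.dist_concat_left rfl hiN]
  have hg : IsLip (ρ m) 1 fun z => f (concat h (concat rfl y w') z) :=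
    isLip_iff_le_add.2 fun z z' => by
      have := hle (concat h (concat rfl y w') z) (concat h (concat rfl y w') z')
      rw [hρ.consistent.dist_concat_left h hnN] at this
      simpa using this
  have h3 := hρ.integral_sub_integral_le hmN (condLaw_absolutelyContinuous μ P h (concat rfl y w))
    (condLaw_absolutelyContinuous μ P h (concat rfl y w')) hg hb
  unfold condMean at h1 ⊢
  linarith

lemma concat_eq_snoc {X : Type*} {i : ℕ} (y : Fin i → X) (w : Fin 1 → X) :
    concat (rfl : i + 1 = i + 1) y w = Fin.snoc (α := fun _ => X) y (w 0) :=
  Fin.append_right_eq_snoc y w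

/-- The martingale differences of a `1`-Lipschitz function are bounded by the row sums of the
mixing matrix. -/
lemma IsPsiDominated.ae_abs_condMean_sub_le {X : Type*} [MeasurableSpace X] {μ : Measure X}
    [SigmaFinite μ] {ρ : ∀ k : ℕ, MetricSpace (Fin k → X)} {N : ℕ∞} (hρ : IsPsiDominated ρ μ N)
    {n : ℕ} (hnN : (n : ℕ∞) ≤ N) (P : Measure (Fin n → X)) [IsProbabilityMeasure P]
    (hP : P ≪ prodMeasure μ n) {f : (Fin n → X) → ℝ} (hf : IsLip (ρ n) 1 f) {C : ℝ}
    (hC0 : 0 ≤ C) (hC : ∀ x, |f x| ≤ C) (i : Fin n) {l : ℕ} (h₀ : i.val + l = n)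
    (h : i.val + 1 + (n - (i.val + 1)) = n) :
    ∀ᵐ a ∂(P.map (initialPart h)),
      |condMean μ P h f a - condMean μ P h₀ f (initialPart (rfl : i.val + 1 = i.val + 1) a)|
        ≤ opNormInfty (mixingMatrix μ P) := by
  have hn : 1 ≤ n := by have := i.isLt; omega
  have hfm : Measurable f := hρ.consistent.measurable hn hnN hf
  have := Measure.isProbabilityMeasure_map (μ := P) (measurable_initialPart h).aemeasurable
  set Q := P.map (initialPart h) with hQ
  have hQμ : Q ≪ prodMeasure μ (i.val + 1) := map_initialPart_absolutelyContinuous hP h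
  have hmap : Q.map (initialPart (rfl : i.val + 1 = i.val + 1)) = P.map (initialPart h₀) := by
    rw [hQ, Measure.map_map (measurable_initialPart _) (measurable_initialPart _)]
    rfl
  have h1N : ((1 : ℕ) : ℕ∞) ≤ N := le_trans (by exact_mod_cast hn) hnN
  choose Nul hNul hle using fun (j : Fin n) (hij : i < j) =>
    exists_null_eta_le_etaBar μ P i j hij h
  -- The points at which the bound on the difference can be applied.
  have hgood : ∀ᵐ a ∂Q, IsProbabilityMeasure (condLaw μ P h a) ∧
      ∀ (j : Fin n) (hij : i < j), a ∉ Nul j hij :=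
    (ae_isProbabilityMeasure_condLaw μ P hP h).and (ae_all_iff.2 fun j => by
      by_cases hij : i < j
      · filter_upwards [measure_eq_zero_iff_ae_notMem.1 (hNul j hij)] with a ha _
        exact ha
      · exact Filter.Eventually.of_forall fun a hij' => absurd hij' hij)
  have hpair : ∀ (y : Fin i.val → X) (w w' : Fin 1 → X),
      (IsProbabilityMeasure (condLaw μ P h (concat rfl y w)) ∧
        ∀ (j : Fin n) (hij : i < j), concat rfl y w ∉ Nul j hij) →
      (IsProbabilityMeasure (condLaw μ P h (concat rfl y w')) ∧
        ∀ (j : Fin n) (hij : i < j), concat rfl y w' ∉ Nul j hij) →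
      (ρ 1).dist w w' ≤ 1 →
      condMean μ P h f (concat rfl y w) - condMean μ P h f (concat rfl y w')
        ≤ opNormInfty (mixingMatrix μ P) := by
    intro y w w' hw hw' hww
    have h1 := hρ.condMean_sub_condMean_le hnN P h hf hC y w w' hw.1 hw'.1
      (b := etaBarShift μ P i) (fun k l h' hl => by
        have hk : i.val + 1 + k < n := by omega
        have hij : i < ⟨i.val + 1 + k, hk⟩ := Fin.lt_def.2 (by simp only; omega)
        have hw2 := hw.2 _ hij
        have hw2' := hw'.2 _ hij
        simp only [concat_eq_snoc] at hw2 hw2' ⊢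
        rw [tvNorm_condLawTail_eq_eta μ P hij h h' (by simp), etaBarShift, dif_pos hk]
        exact hle _ hij y (w 0) (w' 0) hw2 hw2')
    linarith [one_add_sum_etaBarShift_le μ P i]
  have hy : ∀ᵐ y ∂(Q.map (initialPart (rfl : i.val + 1 = i.val + 1))),
      IsProbabilityMeasure (condLaw μ Q (rfl : i.val + 1 = i.val + 1) y) ∧
      (∀ᵐ w ∂(condLaw μ Q (rfl : i.val + 1 = i.val + 1) y),
        IsProbabilityMeasure (condLaw μ P h (concat rfl y w)) ∧
        ∀ (j : Fin n) (hij : i < j), concat rfl y w ∉ Nul j hij) ∧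
      condMean μ P h₀ f y
        = condMean μ Q (rfl : i.val + 1 = i.val + 1) (condMean μ P h f) y := by
    have htower := condMean_ae_eq_condMean_condMean μ P hP h₀ h hfm hC0 hC
    rw [← hmap] at htower
    exact (ae_isProbabilityMeasure_condLaw μ Q hQμ rfl).and
      ((ae_condLaw_of_ae μ Q hQμ rfl hgood).and htower)
  filter_upwards [hgood, ae_of_ae_map (measurable_initialPart rfl).aemeasurable hy]
    with a ha hya
  obtain ⟨hprob, hgood', hmean⟩ := hya
  set y := initialPart (rfl : i.val + 1 = i.val + 1) a with hydef
  set w := finalPart (rfl : i.val + 1 = i.val + 1) a with hwdef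
  have haw : concat rfl y w = a := concat_initialPart_finalPart rfl a
  rw [← haw] at ha ⊢
  have hint : Integrable (fun w' => condMean μ P h f (concat rfl y w'))
      (condLaw μ Q (rfl : i.val + 1 = i.val + 1) y) :=
    Integrable.of_bound ((measurable_condMean μ P h hfm).comp
      (measurable_concat_right rfl y)).aestronglyMeasurable C
      (Filter.Eventually.of_forall fun w' => abs_condMean_le μ P h hC0 hC _)
  have hdiff : condMean μ P h f (concat rfl y w) - condMean μ P h₀ f y
      = ∫ w', (condMean μ P h f (concat rfl y w) - condMean μ P h f (concat rfl y w'))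
        ∂(condLaw μ Q (rfl : i.val + 1 = i.val + 1) y) := by
    rw [integral_sub (integrable_const _) hint, hmean]
    simp [condMean]
  rw [hdiff]
  have hbound : ∀ᵐ w' ∂(condLaw μ Q (rfl : i.val + 1 = i.val + 1) y),
      ‖condMean μ P h f (concat rfl y w) - condMean μ P h f (concat rfl y w')‖
        ≤ opNormInfty (mixingMatrix μ P) := by
    filter_upwards [hgood', (condLaw_absolutelyContinuous μ Q rfl y).ae_le
      (hρ.ae_dist_le le_rfl h1N w)] with w' hw' hd
    rw [Nat.cast_one] at hd
    rw [Real.norm_eq_abs, abs_sub_le_iff]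
    exact ⟨hpair y w w' ha hw' ((ρ 1).dist_comm w w' ▸ hd), hpair y w' w hw' ha hd⟩
  simpa using norm_integral_le_of_norm_le_const hbound

/-! ### Concentration -/

lemma condMean_initialPart_zero {X : Type*} [MeasurableSpace X] (μ : Measure X) [SigmaFinite μ]
    {m n : ℕ} (P : Measure (Fin n → X)) [IsProbabilityMeasure P] (hP : P ≪ prodMeasure μ n)
    (h : 0 + m = n) {f : (Fin n → X) → ℝ} (hf : Integrable f P) (x : Fin n → X) :
    condMean μ P h f (initialPart h x) = ∫ z, f z ∂P := by
  have := Measure.isProbabilityMeasure_map (μ := P) (measurable_initialPart h).aemeasurable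
  rw [integral_eq_integral_condLaw μ P hP h hf]
  have : ∀ y, ∫ z, f (concat h y z) ∂(condLaw μ P h y) = condMean μ P h f (initialPart h x) :=
    fun y => by rw [Subsingleton.elim y (initialPart h x), condMean]
  simp_rw [this]
  simp

lemma ae_condMean_initialPart_self {X : Type*} [MeasurableSpace X] (μ : Measure X) [SigmaFinite μ]
    {n : ℕ} (P : Measure (Fin n → X)) [IsProbabilityMeasure P] (hP : P ≪ prodMeasure μ n)
    (h : n + 0 = n) (f : (Fin n → X) → ℝ) :
    ∀ᵐ x ∂P, condMean μ P h f (initialPart h x) = f x := by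
  filter_upwards [ae_of_ae_map (measurable_initialPart h).aemeasurable
    (ae_isProbabilityMeasure_condLaw μ P hP h)] with x hx
  have : ∀ z, f (concat h (initialPart h x) z) = f x := fun z => by
    rw [Subsingleton.elim z (finalPart h x), concat_initialPart_finalPart]
  simp [condMean, this]

lemma integral_mul_eq_integral_mul_condMean_initialPart {X : Type*} [MeasurableSpace X]
    (μ : Measure X) [SigmaFinite μ] {i m n : ℕ} (P : Measure (Fin n → X)) [IsProbabilityMeasure P]
    (hP : P ≪ prodMeasure μ n) (h : i + m = n) {f : (Fin n → X) → ℝ} (hf : Measurable f) {C : ℝ}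
    (hC : ∀ x, |f x| ≤ C) {G : (Fin i → X) → ℝ} (hG : Measurable G) {D : ℝ}
    (hD : ∀ y, |G y| ≤ D) :
    ∫ x, G (initialPart h x) * f x ∂P
      = ∫ x, G (initialPart h x) * condMean μ P h f (initialPart h x) ∂P := by
  rw [integral_mul_eq_integral_mul_condMean μ P hP h hf hC hG hD]
  exact integral_map (measurable_initialPart h).aemeasurable
    (hG.mul (measurable_condMean μ P h hf)).aestronglyMeasurable

/-- A Lipschitz function on a `Ψ`-dominated space is bounded. -/
lemma IsPsiDominated.exists_abs_le {X : Type*} [MeasurableSpace X] {μ : Measure X}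
    [SigmaFinite μ] {ρ : ∀ k : ℕ, MetricSpace (Fin k → X)} {N : ℕ∞} (hρ : IsPsiDominated ρ μ N)
    {n : ℕ} (hn : 1 ≤ n) (hnN : (n : ℕ∞) ≤ N) {P : Measure (Fin n → X)} [IsProbabilityMeasure P]
    (hP : P ≪ prodMeasure μ n) {f : (Fin n → X) → ℝ} {K : ℝ≥0} (hf : IsLip (ρ n) K f) :
    ∃ C, 0 ≤ C ∧ ∀ x, |f x| ≤ C := by
  have hμ0 : prodMeasure μ n ≠ 0 := fun h0 => by
    rw [h0] at hP
    exact IsProbabilityMeasure.ne_zero P (Measure.absolutelyContinuous_zero_iff.1 hP)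
  obtain ⟨x₀⟩ : Nonempty (Fin n → X) := nonempty_of_isProbabilityMeasure P
  have hle := isLip_iff_le_add.1 hf
  have hd : ∀ x y, (K : ℝ) * (ρ n).dist x y ≤ K * (2 * n) := fun x y =>
    mul_le_mul_of_nonneg_left (hρ.dist_le hn hnN hμ0 x y) K.2
  refine ⟨|f x₀| + K * (2 * n), by positivity, fun x => abs_le.2 ⟨?_, ?_⟩⟩
  · linarith [hle x₀ x, hd x₀ x, neg_abs_le (f x₀)]
  · linarith [hle x x₀, hd x x₀, le_abs_self (f x₀)]

/-- Iterating the one-step bound along the conditional means of `f`, from the mean of `f` (no term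
given) on. -/
lemma IsPsiDominated.integral_exp_condMean_le {X : Type*} [MeasurableSpace X] {μ : Measure X}
    [SigmaFinite μ] {ρ : ∀ k : ℕ, MetricSpace (Fin k → X)} {N : ℕ∞} (hρ : IsPsiDominated ρ μ N)
    {n : ℕ} (hn : 1 ≤ n) (hnN : (n : ℕ∞) ≤ N) (P : Measure (Fin n → X)) [IsProbabilityMeasure P]
    (hP : P ≪ prodMeasure μ n) {f : (Fin n → X) → ℝ} (hf : IsLip (ρ n) 1 f) (s : ℝ) (i m : ℕ)
    (h : i + m = n) :
    ∫ x, Real.exp (s * condMean μ P h f (initialPart h x)) ∂P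
      ≤ Real.exp (s ^ 2 * (i * opNormInfty (mixingMatrix μ P) ^ 2) / 2)
        * Real.exp (s * ∫ z, f z ∂P) := by
  obtain ⟨C, hC0, hC⟩ := hρ.exists_abs_le hn hnN hP hf
  have hfm : Measurable f := hρ.consistent.measurable hn hnN hf
  set c := opNormInfty (mixingMatrix μ P) with hc
  have hc1 : 1 ≤ c := one_le_opNormInfty_mixingMatrix μ hn P
  induction i generalizing m with
  | zero =>
    have hfi : Integrable f P :=
      Integrable.of_bound hfm.aestronglyMeasurable C (Filter.Eventually.of_forall hC)
    simp [condMean_initialPart_zero μ P hP h hfi]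
  | succ i ih =>
    have h₀ : i + (m + 1) = n := by omega
    obtain rfl : m = n - (i + 1) := by omega
    have hU := (measurable_condMean μ P h₀ hfm).comp (measurable_initialPart h₀)
    have hV := (measurable_condMean μ P h hfm).comp (measurable_initialPart h)
    have hd : ∀ᵐ x ∂P, |condMean μ P h f (initialPart h x)
        - condMean μ P h₀ f (initialPart h₀ x)| ≤ c :=
      ae_of_ae_map (measurable_initialPart h).aemeasurable
        (hρ.ae_abs_condMean_sub_le hnN P hP hf hC0 hC ⟨i, by omega⟩ h₀ h)
    -- Both sides of the orthogonality relation are equal to `∫ G f`, where `G` depends on the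
    -- first `i` terms only.
    set G : (Fin i → X) → ℝ := fun y => Real.exp (s * condMean μ P h₀ f y) with hG
    have hGm : Measurable G := ((measurable_condMean μ P h₀ hfm).const_mul s).exp
    have hGb : ∀ y, |G y| ≤ Real.exp (|s| * C) := fun y => by
      rw [hG, Real.abs_exp]
      refine Real.exp_le_exp.2 ((le_abs_self _).trans ?_)
      rw [abs_mul]
      exact mul_le_mul_of_nonneg_left (abs_condMean_le μ P h₀ hC0 hC y) (abs_nonneg s)
    have horth : ∫ x, G (initialPart h₀ x) * condMean μ P h f (initialPart h x) ∂P
        = ∫ x, G (initialPart h₀ x) * condMean μ P h₀ f (initialPart h₀ x) ∂P :=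
      (integral_mul_eq_integral_mul_condMean_initialPart μ P hP h hfm hC
        (hGm.comp (measurable_initialPart (rfl : i + 1 = i + 1))) fun y => hGb _).symm.trans
        (integral_mul_eq_integral_mul_condMean_initialPart μ P hP h₀ hfm hC hGm hGb)
    have hstep := integral_exp_le_of_orthogonal (P := P) hU hV (C := C) (c := c) (l := s)
      (by linarith) (fun x => abs_condMean_le μ P h₀ hC0 hC _)
      (fun x => abs_condMean_le μ P h hC0 hC _) hd horth
    refine hstep.trans ((mul_le_mul_of_nonneg_left (ih (m := n - (i + 1) + 1) h₀)
      (Real.exp_pos _).le).trans (le_of_eq ?_))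
    rw [← mul_assoc, ← Real.exp_add]
    congr 2
    push_cast
    ring

lemma IsPsiDominated.measureReal_deviation_le_of_isLip_one {X : Type*} [MeasurableSpace X]
    {μ : Measure X} [SigmaFinite μ] {ρ : ∀ k : ℕ, MetricSpace (Fin k → X)} {N : ℕ∞}
    (hρ : IsPsiDominated ρ μ N) {n : ℕ} (hn : 1 ≤ n) (hnN : (n : ℕ∞) ≤ N)
    (P : Measure (Fin n → X)) [IsProbabilityMeasure P] (hP : P ≪ prodMeasure μ n)
    {f : (Fin n → X) → ℝ} (hf : IsLip (ρ n) 1 f) {t : ℝ} (ht : 0 < t) :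
    P.real {x | t < |f x - ∫ z, f z ∂P|} ≤
      2 * Real.exp (-(t ^ 2 / (2 * (n * opNormInfty (mixingMatrix μ P) ^ 2)))) := by
  obtain ⟨C, hC0, hC⟩ := hρ.exists_abs_le hn hnN hP hf
  have hc1 : 1 ≤ opNormInfty (mixingMatrix μ P) := one_le_opNormInfty_mixingMatrix μ hn P
  have hn' : (0 : ℝ) < n := by exact_mod_cast hn
  refine measureReal_deviation_le_of_integral_exp_le (hρ.consistent.measurable hn hnN hf) hC
    (by positivity) (fun s => ?_) ht
  refine le_trans (le_of_eq (integral_congr_ae ?_))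
    (hρ.integral_exp_condMean_le hn hnN P hP hf s n 0 (Nat.add_zero n))
  filter_upwards [ae_condMean_initialPart_self μ P hP (Nat.add_zero n) f] with x hx
  rw [hx]

lemma IsPsiDominated.measureReal_deviation_le {X : Type*} [MeasurableSpace X]
    {μ : Measure X} [SigmaFinite μ] {ρ : ∀ k : ℕ, MetricSpace (Fin k → X)} {N : ℕ∞}
    (hρ : IsPsiDominated ρ μ N) {n : ℕ} (hn : 1 ≤ n) (hnN : (n : ℕ∞) ≤ N)
    (P : Measure (Fin n → X)) [IsProbabilityMeasure P] (hP : P ≪ prodMeasure μ n)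
    {f : (Fin n → X) → ℝ} {K : ℝ≥0} (hK : 0 < K) (hf : IsLip (ρ n) K f) {t : ℝ} (ht : 0 < t) :
    P.real {x | t < |f x - ∫ z, f z ∂P|} ≤
      2 * Real.exp (-(t ^ 2 / (2 * n * (K : ℝ) ^ 2 * opNormInfty (mixingMatrix μ P) ^ 2))) := by
  have hK' : (0 : ℝ) < K := hK
  have hg : IsLip (ρ n) 1 fun x => f x / K := isLip_iff_le_add.2 fun x y => by
    have := isLip_iff_le_add.1 hf x y
    rw [div_le_iff₀ hK', add_mul, div_mul_cancel₀ _ hK'.ne']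
    simp only [NNReal.coe_one, one_mul]
    linarith
  have h1 := hρ.measureReal_deviation_le_of_isLip_one hn hnN P hP hg (div_pos ht hK')
  have hset : {x | t / K < |f x / K - ∫ z, f z / K ∂P|} = {x | t < |f x - ∫ z, f z ∂P|} := by
    ext x
    simp only [Set.mem_ofPred_eq]
    rw [integral_div, ← sub_div, abs_div, abs_of_pos hK', div_lt_div_iff_of_pos_right hK']
  rw [hset] at h1
  refine h1.trans (le_of_eq ?_)
  congr 3
  rw [div_pow, div_div]
  congr 1
  ring

lemma isLip_lipConst {Y : Type*} {ρ : MetricSpace Y} {f : Y → ℝ} (hf : ∃ K, IsLip ρ K f) :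
    IsLip ρ (lipConst ρ f) f := by
  have hclosed : IsClosed {K : ℝ≥0 | IsLip ρ K f} := by
    simp only [isLip_iff_le_add, Set.ofPred_forall]
    exact isClosed_iInter fun x => isClosed_iInter fun y =>
      isClosed_le continuous_const (by fun_prop)
  exact hclosed.csInf_mem hf (OrderBot.bddBelow _)

lemma IsPsiDominated.integrable {X : Type*} [MeasurableSpace X]
    {μ : Measure X} [SigmaFinite μ] {ρ : ∀ k : ℕ, MetricSpace (Fin k → X)} {N : ℕ∞}
    (hρ : IsPsiDominated ρ μ N) {n : ℕ} (hn : 1 ≤ n) (hnN : (n : ℕ∞) ≤ N)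
    (P : Measure (Fin n → X)) [IsProbabilityMeasure P] (hP : P ≪ prodMeasure μ n)
    {f : (Fin n → X) → ℝ} {K : ℝ≥0} (hf : IsLip (ρ n) K f) : Integrable f P := by
  obtain ⟨C, -, hC⟩ := hρ.exists_abs_le hn hnN hP hf
  exact Integrable.of_bound (hρ.consistent.measurable hn hnN hf).aestronglyMeasurable C
    (Filter.Eventually.of_forall hC)

lemma measureReal_deviation_eq_zero_of_isLip_zero {Y : Type*} [MeasurableSpace Y]
    {ρ : MetricSpace Y} (P : Measure Y) [IsProbabilityMeasure P] {f : Y → ℝ} (hf : IsLip ρ 0 f)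
    {t : ℝ} (ht : 0 < t) : P.real {x | t < |f x - ∫ z, f z ∂P|} = 0 := by
  have hle : ∀ x y, f x ≤ f y := fun x y => by simpa using isLip_iff_le_add.1 hf x y
  have hset : {x | t < |f x - ∫ z, f z ∂P|} = ∅ := by
    refine Set.eq_empty_iff_forall_notMem.2 fun x hx => ?_
    have hconst : ∫ z, f z ∂P = f x := by
      rw [integral_congr_ae (Filter.Eventually.of_forall fun z => le_antisymm (hle z x) (hle x z))]
      simp
    rw [Set.mem_ofPred_eq, hconst, sub_self, abs_zero] at hx
    exact lt_asymm ht hx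
  rw [hset, measureReal_empty]

lemma isLip_of_isLip_normalizedMetric {X : Type*} {ρ : ∀ k : ℕ, MetricSpace (Fin k → X)} {n : ℕ+}
    {f : (Fin n → X) → ℝ} (hf : IsLip (normalizedMetric ρ n) 1 f) :
    IsLip (ρ n) (1 / (n : ℕ)) f := isLip_iff_le_add.2 fun x y => by
  have := isLip_iff_le_add.1 hf x y
  change f x ≤ f y + ((1 : ℝ≥0) : ℝ) * (1 / ((n : ℕ) : ℝ) * (ρ n).dist x y) at this
  simpa using this

lemma IsPsiDominated.measureReal_deviation_le_of_normalizedMetric {X : Type*} [MeasurableSpace X]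
    {μ : Measure X} [SigmaFinite μ] {ρ : ∀ k : ℕ, MetricSpace (Fin k → X)} {N : ℕ∞}
    (hρ : IsPsiDominated ρ μ N) {n : ℕ+} (hnN : ((n : ℕ) : ℕ∞) ≤ N)
    (P : Measure (Fin n → X)) [IsProbabilityMeasure P] (hP : P ≪ prodMeasure μ n)
    {f : (Fin n → X) → ℝ} (hf : IsLip (normalizedMetric ρ n) 1 f) {t : ℝ} (ht : 0 < t) :
    P.real {x | t < |f x - ∫ z, f z ∂P|} ≤
      2 * Real.exp (-(n * t ^ 2 / (2 * opNormInfty (mixingMatrix μ P) ^ 2))) := by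
  have hn : (0 : ℝ) < (n : ℕ) := by exact_mod_cast n.pos
  refine (hρ.measureReal_deviation_le n.pos hnN P hP (K := 1 / (n : ℕ))
    (by have := n.pos; positivity) (isLip_of_isLip_normalizedMetric hf) ht).trans (le_of_eq ?_)
  congr 3
  have hc1 : 1 ≤ opNormInfty (mixingMatrix μ P) := one_le_opNormInfty_mixingMatrix μ n.pos P
  push_cast
  field_simp

/-- Passing from deviations of Lipschitz functions to the concentration function: the distance
from a set `A` with `P(A) ≥ 1/2` deviates from its mean by more than `t / 2` on `A` if the mean
exceeds `t / 2`, and outside of the fattening of `A` otherwise. -/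
lemma concentrationFunction_le_of_deviation {Y : Type*} [MeasurableSpace Y] (ρ : MetricSpace Y)
    (P : Measure Y) [IsProbabilityMeasure P] (hm : ∀ f : Y → ℝ, IsLip ρ 1 f → Measurable f)
    {t B : ℝ}
    (hdev : ∀ f : Y → ℝ, IsLip ρ 1 f → P.real {x | t / 2 < |f x - ∫ z, f z ∂P|} ≤ B) :
    concentrationFunction ρ P t ≤ 2 * B := by
  have hne : {r : ℝ | ∃ A : Set Y, MeasurableSet A ∧ 1 / 2 ≤ P.real A ∧
      r = P.real (fattening ρ A t)}.Nonempty :=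
    ⟨_, Set.univ, MeasurableSet.univ, by simp; norm_num, rfl⟩
  have hmain : 1 - 2 * B ≤ sInf {r : ℝ | ∃ A : Set Y, MeasurableSet A ∧ 1 / 2 ≤ P.real A ∧
      r = P.real (fattening ρ A t)} := by
    refine le_csInf hne ?_
    rintro _ ⟨A, hA, hPA, rfl⟩
    let _ := ρ
    set f : Y → ℝ := fun x => Metric.infDist x A with hf
    have hfl : IsLip ρ 1 f := Metric.lipschitz_infDist_pt A
    have hB := hdev f hfl
    have hfatt : MeasurableSet (fattening ρ A t) := measurableSet_le (hm f hfl) measurable_const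
    by_cases hmean : ∫ z, f z ∂P ≤ t / 2
    · have hsub : (fattening ρ A t)ᶜ ⊆ {x | t / 2 < |f x - ∫ z, f z ∂P|} := fun x hx => by
        have hx' : t < f x := not_le.1 hx
        have hlt : t / 2 < f x - ∫ z, f z ∂P := by linarith
        exact hlt.trans_le (le_abs_self _)
      have h1 := measureReal_mono (μ := P) hsub
      rw [probReal_compl_eq_one_sub hfatt] at h1
      have h2 := measureReal_nonneg (μ := P) (s := {x | t / 2 < |f x - ∫ z, f z ∂P|})
      linarith
    · have hsub : A ⊆ {x | t / 2 < |f x - ∫ z, f z ∂P|} := fun x hx => by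
        have hx' : f x = 0 := Metric.infDist_zero_of_mem hx
        rw [Set.mem_ofPred_eq, hx', zero_sub, abs_neg]
        exact lt_of_lt_of_le (not_le.1 hmean) (le_abs_self _)
      have h1 := measureReal_mono (μ := P) hsub
      have h2 := measureReal_nonneg (μ := P) (s := fattening ρ A t)
      linarith
  rw [concentrationFunction]
  linarith

lemma IsPsiDominated.diameter_normalizedMetric_lt_top {X : Type*} [MeasurableSpace X]
    {μ : Measure X} [SigmaFinite μ] {ρ : ∀ k : ℕ, MetricSpace (Fin k → X)} {N : ℕ∞}
    (hρ : IsPsiDominated ρ μ N) {n : ℕ+} (hnN : ((n : ℕ) : ℕ∞) ≤ N)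
    (hμ : prodMeasure μ n ≠ 0) : diameter (normalizedMetric ρ n) < ⊤ := by
  let _ := normalizedMetric ρ n
  refine lt_of_le_of_lt (Metric.ediam_le (d := ENNReal.ofReal (1 / (n : ℕ) * (2 * (n : ℕ)))) ?_)
    ENNReal.ofReal_lt_top
  intro x _ y _
  rw [edist_dist]
  exact ENNReal.ofReal_le_ofReal
    (mul_le_mul_of_nonneg_left (hρ.dist_le n.pos hnN hμ x y) (by positivity))

theorem mainTheorem1 {X : Type*} [MeasurableSpace X] (μ : Measure X) [SigmaFinite μ]
    (ρ : ∀ k : ℕ, MetricSpace (Fin k → X))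
    (hsep : @TopologicalSpace.SeparableSpace (Fin 1 → X) (ρ 1).toUniformSpace.toTopologicalSpace) :
    (∀ n : ℕ+, IsPsiDominated ρ μ (n : ℕ) →
      ∀ P : Measure (Fin n → X), IsProbabilityMeasure P → P ≪ prodMeasure μ n →
        (∀ f : (Fin n → X) → ℝ, (∃ K, IsLip (ρ n) K f) →
          Integrable f P ∧ ∀ t : ℝ, 0 < t →
            P.real {x | t < |f x - ∫ z, f z ∂P|} ≤
              2 * Real.exp (-(t ^ 2 / (2 * n * (lipConst (ρ n) f : ℝ) ^ 2 *
                opNormInfty (mixingMatrix μ P) ^ 2))) ∧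
            (lipConst (ρ n) f = 0 → P.real {x | t < |f x - ∫ z, f z ∂P|} = 0)) ∧
        (∀ f : (Fin n → X) → ℝ, IsLip (normalizedMetric ρ n) 1 f → ∀ t : ℝ, 0 < t →
          P.real {x | t < |f x - ∫ z, f z ∂P|} ≤
            2 * Real.exp (-(n * t ^ 2 / (2 * opNormInfty (mixingMatrix μ P) ^ 2))))) ∧
    (IsPsiDominated ρ μ ⊤ →
      ∀ P : ∀ n : ℕ+, Measure (Fin n → X), (∀ n, IsProbabilityMeasure (P n)) →
        (∀ n : ℕ+, P n ≪ prodMeasure μ n) → IsEtaMixing μ P →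
        (∀ (n : ℕ+) (f : (Fin n → X) → ℝ), IsLip (normalizedMetric ρ n) 1 f → ∀ t : ℝ, 0 < t →
          (P n).real {x | t < |f x - ∫ z, f z ∂(P n)|} ≤
            2 * Real.exp (-(n * t ^ 2 /
              (2 * (⨆ k : ℕ+, opNormInfty (mixingMatrix μ (P k))) ^ 2)))) ∧
        IsNormalLevyFamily (normalizedMetric ρ) P) := by
  refine ⟨fun n hρ P _ hP => ⟨fun f hf => ?_, fun f hf t ht =>
    hρ.measureReal_deviation_le_of_normalizedMetric le_rfl P hP hf ht⟩,
    fun hρ P hprob hP hmix => ?_⟩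
  · have hlip := isLip_lipConst hf
    refine ⟨hρ.integrable n.pos le_rfl P hP hlip, fun t ht => ?_⟩
    have hzero : lipConst (ρ n) f = 0 → P.real {x | t < |f x - ∫ z, f z ∂P|} = 0 := fun h0 =>
      measureReal_deviation_eq_zero_of_isLip_zero P (h0 ▸ hlip) ht
    refine ⟨?_, hzero⟩
    -- For a vanishing Lipschitz constant the quotient in the exponent is a division by zero.
    rcases eq_or_ne (lipConst (ρ n) f) 0 with h0 | h0
    · rw [hzero h0]
      positivity
    · exact hρ.measureReal_deviation_le n.pos le_rfl P hP (pos_iff_ne_zero.2 h0) hlip ht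
  · set H := ⨆ k : ℕ+, opNormInfty (mixingMatrix μ (P k)) with hH
    have hle : ∀ n : ℕ+, opNormInfty (mixingMatrix μ (P n)) ≤ H := fun n => le_ciSup hmix n
    have hone : ∀ n : ℕ+, 1 ≤ opNormInfty (mixingMatrix μ (P n)) := fun n =>
      one_le_opNormInfty_mixingMatrix μ n.pos (P n)
    have hH0 : 0 < H := lt_of_lt_of_le zero_lt_one ((hone 1).trans (hle 1))
    have hdev : ∀ (n : ℕ+) (f : (Fin n → X) → ℝ), IsLip (normalizedMetric ρ n) 1 f →
        ∀ t : ℝ, 0 < t → (P n).real {x | t < |f x - ∫ z, f z ∂(P n)|} ≤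
          2 * Real.exp (-(n * t ^ 2 / (2 * H ^ 2))) := fun n f hf t ht => by
      have := hprob n
      refine (hρ.measureReal_deviation_le_of_normalizedMetric le_top (P n) (hP n) hf ht).trans ?_
      have h1 := hone n
      have h2 := hle n
      gcongr
    refine ⟨hdev, fun n => ?_, 4, 1 / (8 * H ^ 2), by norm_num, by positivity, fun n t ht => ?_⟩
    · have := hprob n
      refine hρ.diameter_normalizedMetric_lt_top le_top fun h0 => ?_
      have hPn := hP n
      rw [h0] at hPn
      exact IsProbabilityMeasure.ne_zero (P n) (Measure.absolutelyContinuous_zero_iff.1 hPn)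
    · have := hprob n
      refine (concentrationFunction_le_of_deviation _ (P n)
        (fun f hf => hρ.consistent.measurable n.pos le_top (isLip_of_isLip_normalizedMetric hf))
        fun f hf => hdev n f hf (t / 2) (by positivity)).trans (le_of_eq ?_)
      rw [← mul_assoc]
      congr 1
      · norm_num
      · congr 1
        field_simp
        ring
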